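/- Let $n\ge 3$ be an integer and let $\Lambda<0$ be a real number. For complex-valued functions on $\mathbb R_+^*=(0,\infty)$ set $$B(w,\tilde w)=\int_0^\infty\Big\{\frac1{32}\frac{n^2}{n-1}\,\bar w'\tilde w'+n|\Lambda|t^2\,\bar w\tilde w\Big\}\,dt,\qquad K(w,\tilde w)=\int_0^\infty t^{2-\frac4n}\,\bar w\tilde w\,dt,$$ and let $\mathcal H$ be the completion of $C_c^\infty(\mathbb R_+^*,\mathbb C)$ in the norm $B(w,w)^{1/2}$, regarded as a space of functions on $(0,\infty)$. Then $\mathcal H\subset L^2(\mathbb R_+^*)$, the integral defining $K$ converges absolutely on $\mathcal H\times\mathcal H$, and the generalized eigenvalue problem $$B(w,\varphi)=\lambda K(w,\varphi)\qquad\forall\,\varphi\in\mathcal H,\qquad 0\ne w\in\mathcal H,\ \lambda\in\mathbb C,$$ which is the variational form of $-\frac1{32}\frac{n^2}{n-1}\ddot w+n|\Lambda|t^2w=\lambda t^{2-\frac4n}w$ on $(0,\infty)$, has a sequence of solutions $(w_i,\lambda_i)_{i\ge0}$ with real $\lambda_i$ such that $$0<\lambda_0<\lambda_1<\lambda_2<\cdots,\qquad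 \lim_{i\to\infty}\lambda_i=\infty,\qquad K(w_i,w_j)=\delta_{ij}.$$ Every solution $(w,\lambda)$ of the problem satisfies $\lambda=\lambda_i$ and $w=c\,w_i$ for some $i$ and some constant $c\in\mathbb C$; in particular all eigenvalues are simple. The $w_i$ are complete in $\mathcal H$ as well as in $L^2(\mathbb R_+^*,\mathbb C)$, i.e. their linear span is dense in each of these spaces. -/

import Mathlib

open MeasureTheory Filter Topology Set
open scoped ComplexConjugate ENNReal

namespace TemporalEigenvalue

/-- The open half-line `ℝ_+^* = (0, ∞)` as an open subset of `ℝ`. -/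
def halfLine : TopologicalSpace.Opens ℝ := ⟨Ioi 0, isOpen_Ioi⟩

/-- The test functions `C_c^∞((0, ∞), ℂ)`: smooth functions `ℝ → ℂ` whose (topological) support is
a compact subset of `(0, ∞)`. -/
abbrev Test : Type := TestFunction halfLine ℂ ⊤

/-- The coefficient `(1/32) n² / (n - 1)` of the second derivative. -/
noncomputable def kinCoeff (n : ℕ) : ℝ := 1 / 32 * ((n : ℝ) ^ 2 / ((n : ℝ) - 1))

/-- The potential `n |Λ| t²`. -/
noncomputable def potential (n : ℕ) (Λ t : ℝ) : ℝ := n * |Λ| * t ^ 2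

/-- Lebesgue measure `dt` on `(0, ∞)`. -/
noncomputable def lebesgue : Measure ℝ := volume.restrict (Ioi 0)

/-- The measure `n |Λ| t² dt` on `(0, ∞)`. It has the same null sets as `lebesgue` if `0 < n`
and `Λ ≠ 0`. -/
noncomputable def potMeasure (n : ℕ) (Λ : ℝ) : Measure ℝ :=
  lebesgue.withDensity fun t => ENNReal.ofReal (potential n Λ t)

/-- The measure `(1/32) n² / (n - 1) dt` on `(0, ∞)`. -/
noncomputable def kinMeasure (n : ℕ) : Measure ℝ :=
  lebesgue.withDensity fun _ => ENNReal.ofReal (kinCoeff n)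

lemma continuous_potential (n : ℕ) (Λ : ℝ) : Continuous (potential n Λ) := by
  unfold potential; fun_prop

instance : IsLocallyFiniteMeasure lebesgue := by unfold lebesgue; infer_instance

instance (n : ℕ) (Λ : ℝ) : IsLocallyFiniteMeasure (potMeasure n Λ) :=
  IsLocallyFiniteMeasure.withDensity_ofReal (continuous_potential n Λ)

instance (n : ℕ) : IsLocallyFiniteMeasure (kinMeasure n) :=
  IsLocallyFiniteMeasure.withDensity_ofReal continuous_const

lemma Test.memLp (φ : Test) (n : ℕ) (Λ : ℝ) : MemLp (φ : ℝ → ℂ) 2 (potMeasure n Λ) :=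
  φ.continuous.memLp_of_hasCompactSupport φ.hasCompactSupport

lemma Test.memLp_deriv (φ : Test) (n : ℕ) : MemLp (deriv φ) 2 (kinMeasure n) :=
  (φ.contDiff.continuous_deriv (by simp)).memLp_of_hasCompactSupport φ.hasCompactSupport.deriv

/-- The Hilbert sum of `L²(n |Λ| t² dt)` and `L²((1/32) n² / (n - 1) dt)`, both on `(0, ∞)`. -/
abbrev Ambient (n : ℕ) (Λ : ℝ) : Type :=
  WithLp 2 (Lp ℂ 2 (potMeasure n Λ) × Lp ℂ 2 (kinMeasure n))

/-- The linear map `φ ↦ (φ, φ')`. It is isometric for the norm `B(φ, φ)^{1/2}` on test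
functions, see `energyForm_eq_inner` below. -/
noncomputable def embed (n : ℕ) (Λ : ℝ) : Test →ₗ[ℂ] Ambient n Λ where
  toFun φ := WithLp.toLp 2 ((φ.memLp n Λ).toLp φ, (φ.memLp_deriv n).toLp (deriv φ))
  map_add' φ ψ := by
    have hd : deriv (⇑(φ + ψ)) = deriv φ + deriv ψ := by
      ext t
      exact deriv_add (φ.contDiff.differentiable (by simp) t)
        (ψ.contDiff.differentiable (by simp) t)
    rw [← WithLp.toLp_add, Prod.mk_add_mk, ← MemLp.toLp_add, ← MemLp.toLp_add]
    simp only [hd]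
    rfl
  map_smul' c φ := by
    have hd : deriv (⇑(c • φ)) = c • deriv φ := by
      ext t
      exact deriv_const_smul c (φ.contDiff.differentiable (by simp) t)
    rw [RingHom.id_apply, ← WithLp.toLp_smul, Prod.smul_mk, ← MemLp.toLp_const_smul,
      ← MemLp.toLp_const_smul]
    simp only [hd]
    rfl

/-- The completion `𝓗` of `C_c^∞((0, ∞), ℂ)` in the norm `B(φ, φ)^{1/2}`, realized as the closure
of `{(φ, φ')}` in a Hilbert space whose norm restricts to this norm on the pairs `(φ, φ')`.
Its elements are the pairs `(w, w')`. -/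
noncomputable def energySpace (n : ℕ) (Λ : ℝ) : Submodule ℂ (Ambient n Λ) :=
  (LinearMap.range (embed n Λ)).topologicalClosure

variable {n : ℕ} {Λ : ℝ}

/-- The function `w` on `(0, ∞)`, defined almost everywhere, given by an element of `𝓗`. -/
noncomputable def fn (w : energySpace n Λ) : ℝ → ℂ := (w : Ambient n Λ).fst

/-- The derivative `w'` on `(0, ∞)`, defined almost everywhere, of an element `w` of `𝓗`: the
limit of the derivatives `φ_k'` of test functions `φ_k` that converge to `w` in `𝓗`. -/
noncomputable def dfn (w : energySpace n Λ) : ℝ → ℂ := (w : Ambient n Λ).snd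

/-- `B(w, v) = ∫_0^∞ {(1/32) n² / (n - 1) conj(w') v' + n |Λ| t² conj(w) v} dt` -/
noncomputable def energyForm (w v : energySpace n Λ) : ℂ :=
  ∫ t in Ioi (0 : ℝ),
    ((kinCoeff n : ℂ) * (conj (dfn w t) * dfn v t)
      + (potential n Λ t : ℂ) * (conj (fn w t) * fn v t))

/-- `K(w, v) = ∫_0^∞ t^{2 - 4/n} conj(w) v dt` -/
noncomputable def weightForm (w v : energySpace n Λ) : ℂ :=
  ∫ t in Ioi (0 : ℝ), ((t ^ (2 - 4 / (n : ℝ)) : ℝ) : ℂ) * (conj (fn w t) * fn v t)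

lemma form_aux {ρ : ℝ → ℝ} (hρ : Continuous ρ) (h0 : ∀ t, 0 ≤ ρ t)
    (f g : Lp ℂ 2 (lebesgue.withDensity fun t => ENNReal.ofReal (ρ t))) :
    Integrable (fun t => (ρ t : ℂ) * (conj (f t) * g t)) lebesgue ∧
    inner ℂ f g = ∫ t, (ρ t : ℂ) * (conj (f t) * g t) ∂lebesgue := by
  have hm : Measurable fun t => ENNReal.ofReal (ρ t) := hρ.measurable.ennreal_ofReal
  have hlt : ∀ᵐ t ∂lebesgue, ENNReal.ofReal (ρ t) < ∞ := by simp
  constructor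
  · have h := L2.integrable_inner (𝕜 := ℂ) f g
    rw [integrable_withDensity_iff_integrable_smul' hm hlt] at h
    refine h.congr (Eventually.of_forall fun t => ?_)
    simp [ENNReal.toReal_ofReal (h0 t), mul_comm]
  · rw [L2.inner_def, integral_withDensity_eq_integral_toReal_smul hm hlt]
    congr 1 with t
    simp [ENNReal.toReal_ofReal (h0 t), mul_comm]

/-- `B` is the inner product of `𝓗`. -/
lemma energyForm_eq_inner (hn : 1 ≤ n) (w v : energySpace n Λ) :
    energyForm w v = inner ℂ w v := by
  have hc : 0 ≤ kinCoeff n := by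
    have : (1 : ℝ) ≤ n := by exact_mod_cast hn
    unfold kinCoeff
    have : (0 : ℝ) ≤ n - 1 := by linarith
    positivity
  have hp : ∀ t, 0 ≤ potential n Λ t := fun t => by unfold potential; positivity
  have h1 := form_aux (ρ := fun _ => kinCoeff n) continuous_const (fun _ => hc)
    (w : Ambient n Λ).snd (v : Ambient n Λ).snd
  have h2 := form_aux (continuous_potential n Λ) hp
    (w : Ambient n Λ).fst (v : Ambient n Λ).fst
  rw [Submodule.coe_inner, WithLp.prod_inner_apply]
  refine Eq.trans ?_ (add_comm _ _)
  refine Eq.trans ?_ (congrArg₂ (· + ·) h1.2.symm h2.2.symm)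
  exact integral_add h1.1 h2.1

/-- `(w, μ)` is a solution of the generalized eigenvalue problem
`B(w, φ) = μ K(w, φ)` for all `φ ∈ 𝓗`, with `w ≠ 0`. -/
def IsSolution (w : energySpace n Λ) (μ : ℂ) : Prop :=
  w ≠ 0 ∧ ∀ φ : energySpace n Λ, energyForm w φ = μ * weightForm w φ

end TemporalEigenvalue

/-!
# Discrete spectrum of the temporal eigenvalue problem

The Hilbert space `𝓗` has `B` as its inner product, so the form `K` is represented by a positive
operator `A`, `K(u, v) = ⟪A u, v⟫`, and the eigenvalue problem `B(w, ·) = λ K(w, ·)` becomes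
`w = λ A w`. The theorem then follows from the spectral theorem for compact symmetric operators
(`exists_eigenvector_sequence`), once it is known that `A` is compact and positive definite and that
its eigenvalues are simple.

Everything rests on evaluation at a point. An element `u` of `𝓗` has the continuous representative
`rep u t = ∫₀ᵗ u'` (`fn_ae_eq_rep`), and `rep u t = ⟪k_t, u⟫` for a vector `k_t` that depends
continuously on `t` and satisfies `‖k_t‖² ≤ t / a`, where `a` is the kinetic coefficient. This
controls `u` near `0`, and the potential controls it at infinity, so that `K` is bounded and `𝓗`
lies in `L²` (`integrable_weight_mul_sq`).

* Compactness (`exists_compact_weightOperator`): the form `K` restricted to `(0, R]` is represented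
  by the norm convergent integral `∫₀ᴿ t^{2-4/n} ⟪k_t, ·⟫ k_t dt` of rank one operators, and the
  remainder has norm at most `R^{-4/n} / (n |Λ|)`, because `t^{2-4/n} ≤ R^{-4/n} t²` for `t ≥ R`.
* Simplicity (`exists_eq_smul_of_solutions`): by the du Bois-Reymond lemma, a weak solution
  satisfies `w(0) = 0` and `w' = c + ∫₀ᵗ q w` with `q` continuous up to `t = 0`, since `2 - 4/n ≥ 0`.
  Thus `w` is determined by its slope `c` at `0`.
* Completeness in `L²`: test functions are dense there (`denseRange_inclusion`), so the inclusion of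
  `𝓗` carries a total family to a total family.
-/

namespace TemporalEigenvalue

variable {n : ℕ} {Λ : ℝ}

/-! ### Spectral theory of compact symmetric operators -/

section Abstract

variable {E : Type*} [NormedAddCommGroup E] [InnerProductSpace ℂ E]

lemma eigenvalue_real_pos {T : E →L[ℂ] E} (hsym : (T : E →ₗ[ℂ] E).IsSymmetric)
    (hpos : ∀ x, x ≠ 0 → 0 < (inner ℂ (T x) x).re) {x : E} (hx : x ≠ 0) {μ : ℂ}
    (h : x = μ • T x) : ∃ r : ℝ, 0 < r ∧ μ = r := by
  have hr := hpos x hx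
  have hreal : ((inner ℂ (T x) x).re : ℂ) = inner ℂ (T x) x := by
    rw [← Complex.conj_eq_iff_re, inner_conj_symm]
    exact (hsym x x).symm
  have h1 : (inner ℂ x x : ℂ) = μ * inner ℂ (T x) x := by
    conv_lhs => rw [h, ← h, h, inner_smul_right, ← h]
    rw [← show inner ℂ (T x) x = inner ℂ x (T x) from hsym x x]
  rw [← hreal, inner_self_eq_norm_sq_to_K] at h1
  have hx' : 0 < ‖x‖ := norm_pos_iff.2 hx
  refine ⟨‖x‖ ^ 2 / (inner ℂ (T x) x).re, by positivity, ?_⟩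
  have : ((inner ℂ (T x) x).re : ℂ) ≠ 0 := by exact_mod_cast hr.ne'
  push_cast
  rw [eq_div_iff this]
  exact_mod_cast h1.symm

lemma inner_eq_zero_of_ne {T : E →L[ℂ] E} (hsym : (T : E →ₗ[ℂ] E).IsSymmetric) {x y : E}
    {r s : ℝ} (hx : x = (r : ℂ) • T x) (hy : y = (s : ℂ) • T y) (hrs : r ≠ s) :
    inner ℂ (T x) y = 0 := by
  have h1 : (inner ℂ (T x) y : ℂ) = s * inner ℂ (T x) (T y) := by
    conv_lhs => rw [hy, inner_smul_right]
  have h2 : (inner ℂ x (T y) : ℂ) = r * inner ℂ (T x) (T y) := by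
    conv_lhs => rw [hx, inner_smul_left, Complex.conj_ofReal]
  have h3 : (inner ℂ (T x) y : ℂ) = inner ℂ x (T y) := hsym x y
  have h4 : ((s : ℂ) - r) * inner ℂ (T x) (T y) = 0 := by
    rw [sub_mul, ← h1, ← h2, h3, sub_self]
  have h5 : (s : ℂ) - r ≠ 0 := by
    rw [sub_ne_zero]; exact_mod_cast hrs.symm
  rw [h1, (mul_eq_zero.1 h4).resolve_left h5, mul_zero]

/-- The characteristic values (reciprocals of nonzero eigenvalues) of a compact symmetric operator
cannot accumulate: for unit eigenvectors `u`, `v` to different values `r, s ≤ M` the images satisfy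
`‖T u - T v‖² = r⁻² + s⁻² ≥ M⁻²`, so infinitely many of them contradict compactness. -/
lemma finite_charValues_le {T : E →L[ℂ] E} (hT : IsCompactOperator T)
    (hsym : (T : E →ₗ[ℂ] E).IsSymmetric)
    (hpos : ∀ x, x ≠ 0 → 0 < (inner ℂ (T x) x).re) (M : ℝ) :
    {r : ℝ | r ≤ M ∧ ∃ x : E, x ≠ 0 ∧ x = (r : ℂ) • T x}.Finite := by
  by_contra hinf
  have hinf : {r : ℝ | r ≤ M ∧ ∃ x : E, x ≠ 0 ∧ x = (r : ℂ) • T x}.Infinite := hinf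
  let f := hinf.natEmbedding
  have hf : ∀ k, ∃ x : E, ‖x‖ = 1 ∧ x = ((f k : ℝ) : ℂ) • T x := by
    intro k
    obtain ⟨x, hx, hx'⟩ := (f k).2.2
    refine ⟨((‖x‖⁻¹ : ℝ) : ℂ) • x, ?_, ?_⟩
    · rw [norm_smul, Complex.norm_real, norm_inv, norm_norm, inv_mul_cancel₀]
      exact norm_ne_zero_iff.2 hx
    · rw [map_smul, smul_comm, ← hx']
  choose x hx1 hx2 using hf
  have hfpos : ∀ k, 0 < (f k : ℝ) := by
    intro k
    obtain ⟨r, hr, h⟩ := eigenvalue_real_pos hsym hpos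
      (norm_ne_zero_iff.1 (by rw [hx1 k]; exact one_ne_zero)) (hx2 k)
    rwa [Complex.ofReal_injective h]
  have hM : 0 < M := (hfpos 0).trans_le (f 0).2.1
  have hTx : ∀ k, M⁻¹ ≤ ‖T (x k)‖ := by
    intro k
    have h := congrArg norm (hx2 k)
    rw [norm_smul, hx1, Complex.norm_real, Real.norm_of_nonneg (hfpos k).le] at h
    rw [inv_le_iff_one_le_mul₀ hM, mul_comm, h]
    exact mul_le_mul_of_nonneg_right (f k).2.1 (norm_nonneg _)
  have hsep : ∀ k l, k ≠ l → M⁻¹ ≤ dist (T (x k)) (T (x l)) := by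
    intro k l hkl
    have hne : (f k : ℝ) ≠ f l := fun h => hkl (f.injective (Subtype.ext h))
    have h0 : inner ℂ (T (x k)) (T (x l)) = 0 := by
      have := inner_eq_zero_of_ne hsym (hx2 k) (hx2 l) hne
      rw [hx2 l, inner_smul_right, mul_eq_zero] at this
      rcases this with h | h
      · exact absurd (Complex.ofReal_eq_zero.1 h) (hfpos l).ne'
      · exact h
    rw [dist_eq_norm]
    have h1 := norm_sub_sq (𝕜 := ℂ) (T (x k)) (T (x l))
    rw [h0] at h1
    simp only [map_zero, mul_zero, sub_zero] at h1
    have h2 := hTx k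
    refine h2.trans (abs_le_of_sq_le_sq' ?_ (norm_nonneg _)).2
    rw [h1]
    exact le_add_of_nonneg_right (sq_nonneg _)
  obtain ⟨K, hK, hKT⟩ := hT.image_closedBall_subset_compact (𝕜₁ := ℂ) 1
  have hmem : ∀ k, T (x k) ∈ K := fun k => hKT ⟨x k, by simp [hx1 k], rfl⟩
  obtain ⟨y, -, φ, hφ, hlim⟩ := hK.tendsto_subseq hmem
  obtain ⟨N, hN⟩ := Metric.cauchySeq_iff'.1 hlim.cauchySeq M⁻¹ (inv_pos.2 hM)
  exact absurd (hN (N + 1) (Nat.le_succ N))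
    (not_lt.2 (hsep _ _ (hφ.injective.ne (Nat.succ_ne_self N))))

/-- An infinite set of positive reals without finite accumulation points is enumerated by a
strictly increasing sequence tending to infinity. -/
lemma exists_strictMono_range_eq {S : Set ℝ} (hS : S.Infinite)
    (hfin : ∀ M, {r | r ≤ M ∧ r ∈ S}.Finite) :
    ∃ f : ℕ → ℝ, StrictMono f ∧ Tendsto f atTop atTop ∧ range f = S := by
  classical
  have hIic : ∀ b : S, (Iic b).Finite := fun b => by
    refine Set.Finite.of_finite_image (f := ((↑) : S → ℝ)) ((hfin b).subset ?_)
      Subtype.val_injective.injOn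
    rintro _ ⟨r, hr, rfl⟩
    exact ⟨hr, r.2⟩
  let _ : LocallyFiniteOrder S := LocallyFiniteOrder.ofFiniteIcc fun a b =>
    (hIic b).subset fun _ h => h.2
  let _ : SuccOrder S := LinearLocallyFiniteOrder.succOrder S
  let _ : PredOrder S := LinearLocallyFiniteOrder.predOrder S
  obtain ⟨s₀, hs₀⟩ := hS.nonempty
  let b₀ : S := ⟨s₀, hs₀⟩
  obtain ⟨m, hms, hm⟩ := Set.exists_min_image (Iic b₀) id (hIic b₀) ⟨b₀, mem_Iic.2 le_rfl⟩
  let _ : OrderBot S :=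
    { bot := m
      bot_le := fun r => (le_total r b₀).elim (hm r) hms.out.trans }
  have : NoMaxOrder S := ⟨fun r => by
    by_contra hr
    push Not at hr
    exact hS (((hfin r).subset fun s hs => ⟨hr ⟨s, hs⟩, hs⟩))⟩
  let e := (orderIsoNatOfLinearSuccPredArch (ι := S)).symm
  have hmono : StrictMono fun k => (e k : ℝ) := fun i j hij => e.strictMono hij
  refine ⟨fun k => e k, hmono, ?_, ?_⟩
  · refine tendsto_atTop.2 fun M => ?_
    have : (e ⁻¹' {r : S | (r : ℝ) ≤ M}).Finite :=
      (Set.Finite.of_finite_image (f := ((↑) : S → ℝ)) ((hfin M).subset (by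
        rintro _ ⟨r, hr, rfl⟩
        exact ⟨hr, r.2⟩)) Subtype.val_injective.injOn).preimage e.injective.injOn
    have h2 := this.eventually_cofinite_notMem
    rw [Nat.cofinite_eq_atTop] at h2
    filter_upwards [h2] with k hk
    exact (not_le.1 hk).le
  · ext r
    constructor
    · rintro ⟨k, rfl⟩
      exact (e k).2
    · intro hr
      exact ⟨e.symm ⟨r, hr⟩, by simp⟩

/-- **Eigenvector expansion.** A compact symmetric positive operator with simple eigenvalues on an
infinite-dimensional Hilbert space has a total sequence of eigenvectors `e i`, normalized by
`⟪T (e i), e j⟫ = δᵢⱼ`, with characteristic values increasing to infinity. -/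
theorem exists_eigenvector_sequence [CompleteSpace E] (hE : ¬ FiniteDimensional ℂ E)
    {T : E →L[ℂ] E} (hT : IsCompactOperator T) (hsym : (T : E →ₗ[ℂ] E).IsSymmetric)
    (hpos : ∀ x, x ≠ 0 → 0 < (inner ℂ (T x) x).re)
    (hsimple : ∀ (r : ℝ) (x y : E), x ≠ 0 → x = (r : ℂ) • T x → y = (r : ℂ) • T y →
      ∃ c : ℂ, y = c • x) :
    ∃ (e : ℕ → E) (r : ℕ → ℝ), (∀ i, e i ≠ 0 ∧ e i = (r i : ℂ) • T (e i)) ∧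
      (∀ (x : E) (μ : ℂ), x ≠ 0 → x = μ • T x → ∃ i, μ = r i ∧ ∃ c : ℂ, x = c • e i) ∧
      0 < r 0 ∧ StrictMono r ∧ Tendsto r atTop atTop ∧
      (∀ i j, inner ℂ (T (e i)) (e j) = if i = j then (1 : ℂ) else 0) ∧
      (Submodule.span ℂ (range e)).topologicalClosure = ⊤ := by
  set S : Set ℝ := {r | ∃ x : E, x ≠ 0 ∧ x = (r : ℂ) • T x} with hSdef
  have hfin : ∀ M, {r | r ≤ M ∧ r ∈ S}.Finite := fun M => finite_charValues_le hT hsym hpos M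
  have hreal : ∀ x, ((inner ℂ (T x) x).re : ℂ) = inner ℂ (T x) x := fun x => by
    rw [← Complex.conj_eq_iff_re, inner_conj_symm]
    exact (hsym x x).symm
  have hex : ∀ s : S, ∃ x : E, inner ℂ (T x) x = (1 : ℂ) ∧ x = ((s : ℝ) : ℂ) • T x := by
    rintro ⟨s, x, hx, hxs⟩
    have hr := hpos x hx
    have hsq : (√(inner ℂ (T x) x).re) * (√(inner ℂ (T x) x).re) = (inner ℂ (T x) x).re :=
      Real.mul_self_sqrt hr.le
    refine ⟨(((√(inner ℂ (T x) x).re)⁻¹ : ℝ) : ℂ) • x, ?_, ?_⟩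
    · rw [map_smul, inner_smul_left, inner_smul_right, Complex.conj_ofReal, ← hreal x,
        ← Complex.ofReal_mul, ← Complex.ofReal_mul]
      nth_rewrite 3 [← hsq]
      have h0 : √(inner ℂ (T x) x).re ≠ 0 := (Real.sqrt_pos.2 hr).ne'
      norm_cast
      field_simp
    · rw [map_smul, smul_comm, ← hxs]
  choose e he1 he2 using hex
  have hne : ∀ s, e s ≠ 0 := fun s h => by
    have := he1 s
    rw [h] at this
    simp at this
  have hall : ∀ (x : E) (μ : ℂ), x ≠ 0 → x = μ • T x →
      ∃ s : S, μ = (s : ℝ) ∧ ∃ c : ℂ, x = c • e s := by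
    intro x μ hx h
    obtain ⟨r, -, rfl⟩ := eigenvalue_real_pos hsym hpos hx h
    let s : S := ⟨r, x, hx, h⟩
    exact ⟨s, rfl, hsimple r (e s) x (hne s) (he2 s) h⟩
  have hdense : (Submodule.span ℂ (range e)).topologicalClosure = ⊤ := by
    rw [Submodule.topologicalClosure_eq_top_iff, eq_bot_iff]
    have hle : (⨆ μ, Module.End.eigenspace (T : Module.End ℂ E) μ) ≤
        Submodule.span ℂ (range e) := by
      refine iSup_le fun μ y hy => ?_
      rw [Module.End.mem_eigenspace_iff] at hy
      have hy : T y = μ • y := hy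
      by_cases hy0 : y = 0
      · rw [hy0]; exact zero_mem _
      have hμ : μ ≠ 0 := by
        rintro rfl
        have := hpos y hy0
        rw [hy] at this
        simp at this
      obtain ⟨s, -, c, hc⟩ := hall y μ⁻¹ hy0 (by rw [hy, smul_smul, inv_mul_cancel₀ hμ, one_smul])
      rw [hc]
      exact Submodule.smul_mem _ _ (Submodule.subset_span ⟨s, rfl⟩)
    rw [← ContinuousLinearMap.orthogonalComplement_iSup_eigenspaces_eq_bot hT hsym]
    exact Submodule.orthogonal_le hle
  -- Otherwise the span is finite-dimensional, hence closed, hence everything.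
  have hinf : S.Infinite := by
    intro hSfin
    apply hE
    have : Finite S := hSfin
    have : FiniteDimensional ℂ (Submodule.span ℂ (range e)) :=
      FiniteDimensional.span_of_finite ℂ (finite_range e)
    rw [(Submodule.closed_of_finiteDimensional _).submodule_topologicalClosure_eq] at hdense
    rw [hdense] at this
    exact Module.finite_def.2 (Submodule.fg_top _ |>.1 (Module.finite_def.1 this))
  obtain ⟨f, hf1, hf2, hf3⟩ := exists_strictMono_range_eq hinf hfin
  have hmem : ∀ i, f i ∈ S := fun i => hf3 ▸ mem_range_self i
  have hrange : range (fun i => e ⟨f i, hmem i⟩) = range e := by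
    apply subset_antisymm
    · rintro _ ⟨i, rfl⟩
      exact ⟨_, rfl⟩
    · rintro _ ⟨⟨s, hs⟩, rfl⟩
      obtain ⟨i, rfl⟩ := hf3.symm ▸ hs
      exact ⟨i, rfl⟩
  refine ⟨fun i => e ⟨f i, hmem i⟩, f, fun i => ⟨hne _, he2 _⟩, ?_, ?_, hf1, hf2, ?_, ?_⟩
  · intro x μ hx h
    obtain ⟨⟨s, hs⟩, h1, h2⟩ := hall x μ hx h
    obtain ⟨i, rfl⟩ := hf3.symm ▸ hs
    exact ⟨i, h1, h2⟩
  · obtain ⟨x, hx, h⟩ := hmem 0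
    obtain ⟨r, hr, h'⟩ := eigenvalue_real_pos hsym hpos hx h
    rwa [Complex.ofReal_injective h']
  · intro i j
    split_ifs with hij
    · subst hij
      exact he1 _
    · exact inner_eq_zero_of_ne hsym (he2 _) (he2 _) (hf1.injective.ne hij)
  · rw [hrange, hdense]

end Abstract

/-! ### Point evaluation on the energy space -/

lemma kinCoeff_pos (hn : 2 ≤ n) : 0 < kinCoeff n := by
  have : (2 : ℝ) ≤ n := by exact_mod_cast hn
  unfold kinCoeff
  have : (0 : ℝ) < n - 1 := by linarith
  positivity

lemma lebesgue_absolutelyContinuous_kinMeasure (hn : 2 ≤ n) : lebesgue ≪ kinMeasure n :=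
  withDensity_absolutelyContinuous' aemeasurable_const
    (Eventually.of_forall fun _ => by simpa using kinCoeff_pos hn)

lemma lebesgue_absolutelyContinuous_potMeasure (hn : 2 ≤ n) (hΛ : Λ < 0) :
    lebesgue ≪ potMeasure n Λ := by
  refine withDensity_absolutelyContinuous'
    (continuous_potential n Λ).measurable.ennreal_ofReal.aemeasurable ?_
  refine (ae_restrict_mem measurableSet_Ioi).mono fun t ht => ?_
  have ht : 0 < t := ht
  have hn' : (0 : ℝ) < n := by exact_mod_cast (by omega : 0 < n)
  have : 0 < potential n Λ t := by
    unfold potential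
    have := abs_pos.2 hΛ.ne
    positivity
  simpa using this

lemma kinMeasure_eq : kinMeasure n = ENNReal.ofReal (kinCoeff n) • lebesgue :=
  withDensity_const _

lemma lebesgue_restrict_Ioc (t : ℝ) : lebesgue.restrict (Ioc 0 t) = volume.restrict (Ioc 0 t) := by
  rw [lebesgue, Measure.restrict_restrict measurableSet_Ioc,
    inter_eq_left.2 fun s hs => mem_Ioi.2 hs.1]

lemma kinMeasure_Ioc_ne_top (t : ℝ) : kinMeasure n (Ioc 0 t) ≠ ∞ :=
  ((measure_mono Ioc_subset_Icc_self).trans_lt isCompact_Icc.measure_lt_top).ne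

/-- The continuous representative `t ↦ ∫₀ᵗ w'` of an element `w` of `𝓗`, extended by `0` to
`t ≤ 0`. -/
noncomputable def rep (u : energySpace n Λ) (t : ℝ) : ℂ := ∫ s in Ioc 0 t, dfn u s

/-- The indicator of `(0, t]` in `L²(kinMeasure)`, divided by the kinetic coefficient. -/
noncomputable def stepVec (n : ℕ) (t : ℝ) : Lp ℂ 2 (kinMeasure n) :=
  indicatorConstLp 2 measurableSet_Ioc (kinMeasure_Ioc_ne_top (n := n) t) ((kinCoeff n : ℂ)⁻¹)

instance : CompleteSpace (energySpace n Λ) :=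
  (Submodule.isClosed_topologicalClosure _).completeSpace_coe

/-- The vector of `𝓗` representing evaluation at `t`, see `inner_evalVec`: the projection of
`(0, stepVec n t)` to `𝓗`. -/
noncomputable def evalVec (n : ℕ) (Λ t : ℝ) : energySpace n Λ :=
  (energySpace n Λ).orthogonalProjectionOnto (WithLp.toLp 2 (0, stepVec n t))

lemma inner_stepVec (hn : 2 ≤ n) (t : ℝ) (f : Lp ℂ 2 (kinMeasure n)) :
    inner ℂ (stepVec n t) f = ∫ s in Ioc 0 t, f s := by
  have ha := kinCoeff_pos hn
  have ha' : (kinCoeff n : ℂ) ≠ 0 := by exact_mod_cast ha.ne'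
  have hint : ∀ g : ℝ → ℂ, ∫ x in Ioc 0 t, g x ∂kinMeasure n =
      kinCoeff n * ∫ x in Ioc 0 t, g x := fun g => by
    rw [kinMeasure_eq, Measure.restrict_smul, integral_smul_measure, lebesgue_restrict_Ioc,
      ENNReal.toReal_ofReal ha.le, Complex.real_smul]
  rw [stepVec, L2.inner_indicatorConstLp_eq_setIntegral_inner, hint]
  simp only [RCLike.inner_apply', map_inv₀, Complex.conj_ofReal]
  rw [integral_const_mul, ← mul_assoc, mul_inv_cancel₀ ha', one_mul]

lemma inner_evalVec (hn : 2 ≤ n) (t : ℝ) (u : energySpace n Λ) :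
    inner ℂ (evalVec n Λ t) u = rep u t := by
  rw [evalVec, Submodule.inner_orthogonalProjectionOnto_eq_of_mem_right,
    WithLp.prod_inner_apply, inner_zero_left, zero_add]
  exact inner_stepVec hn t _

lemma norm_stepVec_sq (hn : 2 ≤ n) {t : ℝ} (ht : 0 ≤ t) : ‖stepVec n t‖ ^ 2 = t / kinCoeff n := by
  have ha := kinCoeff_pos hn
  rw [stepVec, norm_indicatorConstLp (by simp) (by simp), mul_pow, kinMeasure_eq]
  have h : (ENNReal.ofReal (kinCoeff n) • lebesgue).real (Ioc 0 t) = kinCoeff n * t := by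
    rw [measureReal_ennreal_smul_apply, ENNReal.toReal_ofReal ha.le, Measure.real,
      ← Measure.restrict_apply_univ, lebesgue_restrict_Ioc]
    simp [ht]
  rw [h, ← Real.rpow_natCast (_ ^ _), ← Real.rpow_mul (by positivity)]
  simp only [norm_inv, Complex.norm_real, Real.norm_of_nonneg ha.le]
  norm_num
  field_simp

lemma norm_evalVec_sq_le (hn : 2 ≤ n) {t : ℝ} (ht : 0 ≤ t) :
    ‖evalVec n Λ t‖ ^ 2 ≤ t / kinCoeff n := by
  rw [← norm_stepVec_sq hn ht]
  refine pow_le_pow_left₀ (norm_nonneg _) ?_ 2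
  refine ((energySpace n Λ).norm_orthogonalProjectionOnto_apply_le _).trans ?_
  rw [WithLp.prod_norm_eq_of_L2]
  simp

lemma continuous_evalVec : Continuous (evalVec n Λ) := by
  refine (energySpace n Λ).orthogonalProjectionOnto.continuous.comp
    ((WithLp.prod_continuous_toLp 2 _ _).comp (continuous_const.prodMk ?_))
  refine continuous_indicatorConstLp_set (by simp) fun t => ?_
  have hb : ∀ s, kinMeasure n (symmDiff (Ioc 0 s) (Ioc 0 t)) ≤
      ENNReal.ofReal (kinCoeff n) * ENNReal.ofReal |s - t| := by
    intro s
    rw [kinMeasure_eq, Measure.smul_apply, smul_eq_mul]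
    gcongr
    have : symmDiff (Ioc 0 s) (Ioc 0 t) ⊆ uIoc t s := by
      intro x hx
      simp only [Set.mem_symmDiff, mem_Ioc, not_and, not_le, mem_uIoc] at *
      tauto
    refine (measure_mono this).trans ((Measure.restrict_apply_le _ _).trans ?_)
    rw [Real.volume_uIoc]
  refine tendsto_of_tendsto_of_tendsto_of_le_of_le tendsto_const_nhds ?_ (fun _ => zero_le) hb
  have : Tendsto (fun s : ℝ => ENNReal.ofReal (kinCoeff n) * ENNReal.ofReal |s - t|) (𝓝 t)
      (𝓝 (ENNReal.ofReal (kinCoeff n) * ENNReal.ofReal |t - t|)) := by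
    refine ENNReal.Tendsto.const_mul (ENNReal.tendsto_ofReal ?_) (Or.inr (by simp))
    exact ((continuous_id.sub continuous_const).abs).tendsto t
  simpa using this

lemma continuous_rep (hn : 2 ≤ n) (u : energySpace n Λ) : Continuous (rep u) := by
  have : rep u = fun t => inner ℂ (evalVec n Λ t) u := funext fun t => (inner_evalVec hn t u).symm
  rw [this]
  exact continuous_evalVec.inner continuous_const

lemma norm_rep_sq_le (hn : 2 ≤ n) (u : energySpace n Λ) {t : ℝ} (ht : 0 ≤ t) :
    ‖rep u t‖ ^ 2 ≤ t / kinCoeff n * ‖u‖ ^ 2 := by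
  rw [← inner_evalVec hn]
  calc _ ≤ (‖evalVec n Λ t‖ * ‖u‖) ^ 2 :=
        pow_le_pow_left₀ (norm_nonneg _) (norm_inner_le_norm (𝕜 := ℂ) _ _) 2
    _ ≤ _ := by
        rw [mul_pow]
        exact mul_le_mul_of_nonneg_right (norm_evalVec_sq_le hn ht) (sq_nonneg _)

/-- A test function as an element of `𝓗`. -/
noncomputable def ofTest (n : ℕ) (Λ : ℝ) (φ : Test) : energySpace n Λ :=
  ⟨embed n Λ φ, Submodule.le_topologicalClosure _ ⟨φ, rfl⟩⟩

lemma fn_ofTest (hn : 2 ≤ n) (hΛ : Λ < 0) (φ : Test) : fn (ofTest n Λ φ) =ᵐ[lebesgue] φ :=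
  (lebesgue_absolutelyContinuous_potMeasure hn hΛ).ae_le (φ.memLp n Λ).coeFn_toLp

lemma dfn_ofTest (hn : 2 ≤ n) (φ : Test) : dfn (ofTest n Λ φ) =ᵐ[lebesgue] deriv φ :=
  (lebesgue_absolutelyContinuous_kinMeasure hn).ae_le (φ.memLp_deriv n).coeFn_toLp

lemma Test.apply_of_nonpos (φ : Test) {t : ℝ} (ht : t ≤ 0) : φ t = 0 := by
  by_contra h
  exact absurd (φ.tsupport_subset (subset_tsupport _ h)) (not_lt.2 ht)

lemma Test.hasDerivAt (φ : Test) (t : ℝ) : HasDerivAt φ (deriv φ t) t :=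
  (φ.contDiff.differentiable (by simp) t).hasDerivAt

lemma Test.continuous_deriv (φ : Test) : Continuous (deriv φ) :=
  φ.contDiff.continuous_deriv (by simp)

lemma rep_ofTest (hn : 2 ≤ n) (φ : Test) {t : ℝ} (ht : 0 ≤ t) : rep (ofTest n Λ φ) t = φ t := by
  have h1 : rep (ofTest n Λ φ) t = ∫ s in Ioc 0 t, deriv φ s := by
    refine integral_congr_ae ?_
    have := ae_restrict_of_ae (s := Ioc 0 t) (dfn_ofTest (Λ := Λ) hn φ)
    rwa [lebesgue_restrict_Ioc] at this
  rw [h1, ← intervalIntegral.integral_of_le ht,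
    intervalIntegral.integral_eq_sub_of_hasDerivAt (fun x _ => φ.hasDerivAt x)
      (φ.continuous_deriv.intervalIntegrable _ _), φ.apply_of_nonpos le_rfl, sub_zero]

/-- Both sides are limits along a sequence of test functions converging to `u`: the left side
because `L²` convergence implies convergence almost everywhere of a subsequence, the right side
because evaluation is continuous on `𝓗`. -/
lemma fn_ae_eq_rep (hn : 2 ≤ n) (hΛ : Λ < 0) (u : energySpace n Λ) : fn u =ᵐ[lebesgue] rep u := by
  obtain ⟨x, hx, hlim⟩ := mem_closure_iff_seq_limit.1 u.2
  choose φ hφ using hx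
  have hlim' : Tendsto (fun k => ofTest n Λ (φ k)) atTop (𝓝 u) := by
    rw [tendsto_subtype_rng]
    exact hlim.congr fun k => (hφ k).symm
  have h1 : Tendsto (fun k => (embed n Λ (φ k)).fst) atTop (𝓝 (u : Ambient n Λ).fst) :=
    ((WithLp.fstL 2 ℂ _ _).continuous.tendsto _).comp (hlim.congr fun k => (hφ k).symm)
  obtain ⟨ns, hns, hae⟩ := (tendstoInMeasure_of_tendsto_Lp h1).exists_seq_tendsto_ae
  have hall : ∀ᵐ t ∂lebesgue, ∀ k, fn (ofTest n Λ (φ k)) t = φ k t :=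
    ae_all_iff.2 fun k => fn_ofTest hn hΛ (φ k)
  filter_upwards [(lebesgue_absolutelyContinuous_potMeasure hn hΛ).ae_le hae, hall,
    ae_restrict_mem measurableSet_Ioi] with t ht1 ht2 ht3
  have ht3 : 0 < t := ht3
  refine tendsto_nhds_unique ht1 ?_
  have h2 : Tendsto (fun k => rep (ofTest n Λ (φ k)) t) atTop (𝓝 (rep u t)) := by
    simp_rw [← inner_evalVec hn]
    exact tendsto_const_nhds.inner hlim'
  refine (h2.comp hns.tendsto_atTop).congr fun k => ?_
  rw [Function.comp_apply, rep_ofTest hn _ ht3.le, ← ht2]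
  rfl

lemma intervalIntegrable_dfn (hn : 2 ≤ n) (u : energySpace n Λ) {t : ℝ} (ht : 0 ≤ t) :
    IntervalIntegrable (dfn u) volume 0 t := by
  rw [intervalIntegrable_iff_integrableOn_Ioc_of_le ht]
  have hm : MemLp (dfn u) 2 (kinMeasure n) := Lp.memLp _
  have h1 : IntegrableOn (dfn u) (Ioc 0 t) (kinMeasure n) := by
    have : IsFiniteMeasure ((kinMeasure n).restrict (Ioc 0 t)) :=
      ⟨by rw [Measure.restrict_apply_univ]; exact (kinMeasure_Ioc_ne_top t).lt_top⟩
    exact (hm.restrict _).integrable (by simp)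
  rw [IntegrableOn, kinMeasure_eq, Measure.restrict_smul, lebesgue_restrict_Ioc] at h1
  exact (integrable_smul_measure (by simpa using kinCoeff_pos hn) (by simp)).1 h1

/-- An element of `𝓗` is determined by its function: the derivative is recovered almost
everywhere by Lebesgue differentiation of the continuous representative. -/
lemma eq_zero_of_rep_eq_zero (hn : 2 ≤ n) (hΛ : Λ < 0) {u : energySpace n Λ}
    (h : ∀ t, 0 < t → rep u t = 0) : u = 0 := by
  have hrep : ∀ t, rep u t = 0 := fun t => by
    rcases le_or_gt t 0 with ht | ht
    · rw [rep, Ioc_eq_empty (not_lt.2 ht), setIntegral_empty]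
    · exact h t ht
  have h1 : ∀ N : ℕ, ∀ᵐ t, t ∈ Ioc 0 (N : ℝ) → dfn u t = 0 := by
    intro N
    have hN : (0 : ℝ) ≤ N := N.cast_nonneg
    filter_upwards [(intervalIntegrable_dfn hn u hN).ae_hasDerivAt_integral,
      Measure.ae_ne volume (N : ℝ)] with t ht htN htI
    rw [uIcc_of_le hN] at ht
    have h2 := ht ⟨htI.1.le, htI.2⟩ 0 ⟨le_rfl, hN⟩
    have h3 : (fun x => ∫ s in (0 : ℝ)..x, dfn u s) =ᶠ[𝓝 t] fun _ => 0 := by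
      filter_upwards [Ioi_mem_nhds htI.1] with x hx
      rw [intervalIntegral.integral_of_le (le_of_lt hx)]
      exact hrep x
    exact h2.unique ((hasDerivAt_const t (0 : ℂ)).congr_of_eventuallyEq h3)
  have hd : dfn u =ᵐ[lebesgue] 0 := by
    rw [Filter.EventuallyEq, lebesgue, ae_restrict_iff' measurableSet_Ioi]
    filter_upwards [ae_all_iff.2 h1] with t ht ht0
    obtain ⟨N, hN⟩ := exists_nat_ge t
    exact ht N ⟨ht0, hN⟩
  have hf : fn u =ᵐ[lebesgue] 0 := (fn_ae_eq_rep hn hΛ u).trans (Eventually.of_forall hrep)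
  have e1 : (u : Ambient n Λ).fst = 0 :=
    (Lp.eq_zero_iff_ae_eq_zero).2 ((withDensity_absolutelyContinuous _ _).ae_le hf)
  have e2 : (u : Ambient n Λ).snd = 0 :=
    (Lp.eq_zero_iff_ae_eq_zero).2 ((withDensity_absolutelyContinuous _ _).ae_le hd)
  refine Subtype.ext ?_
  exact WithLp.ofLp_injective 2 (Prod.ext e1 e2)

lemma fn_add (hn : 2 ≤ n) (hΛ : Λ < 0) (u v : energySpace n Λ) :
    fn (u + v) =ᵐ[lebesgue] fn u + fn v :=
  (lebesgue_absolutelyContinuous_potMeasure hn hΛ).ae_le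
    (Lp.coeFn_add (u : Ambient n Λ).fst (v : Ambient n Λ).fst)

lemma fn_smul (hn : 2 ≤ n) (hΛ : Λ < 0) (c : ℂ) (u : energySpace n Λ) :
    fn (c • u) =ᵐ[lebesgue] c • fn u :=
  (lebesgue_absolutelyContinuous_potMeasure hn hΛ).ae_le
    (Lp.coeFn_smul c (u : Ambient n Λ).fst)

lemma rep_sub_smul (hn : 2 ≤ n) (u v : energySpace n Λ) (c : ℂ) (t : ℝ) :
    rep (u - c • v) t = rep u t - c * rep v t := by
  rw [← inner_evalVec hn, ← inner_evalVec hn, ← inner_evalVec hn, inner_sub_right]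
  exact congrArg _ (inner_smul_right (𝕜 := ℂ) (evalVec n Λ t) v c)

/-! ### Weighted forms and compactness -/

section Operator

variable {E : Type*} [NormedAddCommGroup E] [InnerProductSpace ℂ E]

lemma isCompactOperator_rankOne (x y : E) :
    IsCompactOperator (InnerProductSpace.rankOne ℂ x y) := by
  have h : (InnerProductSpace.rankOne ℂ x y : E →L[ℂ] E) =
      (ContinuousLinearMap.toSpanSingleton ℂ x).comp (innerSL ℂ y) := by
    ext z
    simp
  rw [h]
  exact (isCompactOperator_of_locallyCompactSpace_rng
    (ContinuousLinearMap.toSpanSingleton ℂ x)).comp_clm (innerSL ℂ y)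

/-- The integral converges in operator norm, since `k` is continuous, and it stays in the closed
subspace of compact operators. -/
lemma exists_compactOperator_integral [CompleteSpace E] {ρ : ℝ → ℝ} (hρ : Continuous ρ)
    {k : ℝ → E} (hk : Continuous k) (R : ℝ) :
    ∃ A : E →L[ℂ] E, IsCompactOperator A ∧
      ∀ u v, inner ℂ u (A v) = ∫ t in Ioc 0 R, (ρ t : ℂ) * (inner ℂ u (k t) * inner ℂ (k t) v) := by
  let S : Submodule ℂ (E →L[ℂ] E) := compactOperator (RingHom.id ℂ) E E
  have hSc : IsClosed (S : Set (E →L[ℂ] E)) := isClosed_setOfPred_isCompactOperator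
  have : CompleteSpace S := hSc.completeSpace_coe
  let F : ℝ → E →L[ℂ] E := fun t => (ρ t : ℂ) • InnerProductSpace.rankOne ℂ (k t) (k t)
  have hF : ∀ t, F t ∈ S := fun t => S.smul_mem _ (isCompactOperator_rankOne (k t) (k t))
  have hFc : Continuous F := by
    refine (Complex.continuous_ofReal.comp hρ).smul ?_
    have h : (fun t => InnerProductSpace.rankOne ℂ (k t) (k t)) =
        fun t => ContinuousLinearMap.smulRightL ℂ E E (innerSL ℂ (k t)) (k t) := by
      ext t v
      simp
    rw [h]
    exact ((ContinuousLinearMap.smulRightL ℂ E E).continuous.comp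
      ((innerSL ℂ).continuous.comp hk)).clm_apply hk
  let G : ℝ → S := fun t => ⟨F t, hF t⟩
  have hGc : Continuous G := hFc.subtype_mk _
  have hGi : IntegrableOn G (Ioc 0 R) :=
    (hGc.locallyIntegrable.integrableOn_isCompact isCompact_Icc).mono_set Ioc_subset_Icc_self
  have hFi : IntegrableOn F (Ioc 0 R) :=
    (hFc.locallyIntegrable.integrableOn_isCompact isCompact_Icc).mono_set Ioc_subset_Icc_self
  refine ⟨_, (∫ t in Ioc 0 R, G t).2, fun u v => ?_⟩
  have h1 : ((∫ t in Ioc 0 R, G t : S) : E →L[ℂ] E) = ∫ t in Ioc 0 R, F t :=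
    (S.subtypeL.integral_comp_comm hGi).symm
  have h2 : inner ℂ u (((∫ t in Ioc 0 R, G t : S) : E →L[ℂ] E) v) =
      ∫ t in Ioc 0 R, inner ℂ u (F t v) := by
    rw [h1, ContinuousLinearMap.integral_apply hFi]
    exact (integral_inner (((ContinuousLinearMap.apply ℂ E v).integrable_comp hFi)) u).symm
  refine h2.trans (integral_congr_ae (Eventually.of_forall fun t => ?_))
  simp only [F, smul_apply, InnerProductSpace.rankOne_apply, inner_smul_right]
  ring

lemma isCompactOperator_of_norm_sub_le [CompleteSpace E] {A : E →L[ℂ] E}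
    {B : ℕ → E →L[ℂ] E} (hB : ∀ N, IsCompactOperator (B N))
    {ε : ℕ → ℝ} (hle : ∀ N, ‖A - B N‖ ≤ ε N) (hε : Tendsto ε atTop (𝓝 0)) :
    IsCompactOperator A := by
  refine isCompactOperator_of_tendsto (F := B) (l := atTop) ?_ (Eventually.of_forall hB)
  rw [tendsto_iff_norm_sub_tendsto_zero]
  exact squeeze_zero (fun _ => norm_nonneg _)
    (fun N => (norm_sub_rev (B N) A).trans_le (hle N)) hε

end Operator

lemma aestronglyMeasurable_fn (hn : 2 ≤ n) (hΛ : Λ < 0) (u : energySpace n Λ) :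
    AEStronglyMeasurable (fn u) lebesgue :=
  (Lp.aestronglyMeasurable (u : Ambient n Λ).fst).mono_ac
    (lebesgue_absolutelyContinuous_potMeasure hn hΛ)

lemma potential_nonneg (t : ℝ) : 0 ≤ potential n Λ t := by unfold potential; positivity

lemma norm_fst_le (u : energySpace n Λ) : ‖(u : Ambient n Λ).fst‖ ≤ ‖u‖ := by
  rw [Submodule.coe_norm, WithLp.prod_norm_eq_of_L2]
  exact Real.le_sqrt_of_sq_le (le_add_of_nonneg_right (sq_nonneg _))

lemma integrable_potential_mul_sq (u : energySpace n Λ) :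
    Integrable (fun t => potential n Λ t * ‖fn u t‖ ^ 2) lebesgue ∧
      ∫ t, potential n Λ t * ‖fn u t‖ ^ 2 ∂lebesgue ≤ ‖u‖ ^ 2 := by
  obtain ⟨h1, h2⟩ := form_aux (continuous_potential n Λ) potential_nonneg
    (u : Ambient n Λ).fst (u : Ambient n Λ).fst
  have he : ∀ t, (potential n Λ t : ℂ) * (conj ((u : Ambient n Λ).fst t) *
      (u : Ambient n Λ).fst t) = ((potential n Λ t * ‖fn u t‖ ^ 2 : ℝ) : ℂ) := by
    intro t
    rw [Complex.conj_mul']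
    push_cast
    rfl
  replace h1 := h1.congr (Eventually.of_forall he)
  replace h2 := h2.trans (integral_congr_ae (Eventually.of_forall he))
  refine ⟨h1.re, ?_⟩
  rw [integral_complex_ofReal] at h2
  replace h2 := (inner_self_eq_norm_sq_to_K (𝕜 := ℂ) (u : Ambient n Λ).fst).symm.trans h2
  have h3 : ‖(u : Ambient n Λ).fst‖ ^ 2 = ∫ t, potential n Λ t * ‖fn u t‖ ^ 2 ∂lebesgue := by
    refine Complex.ofReal_injective (Eq.trans ?_ h2)
    push_cast
    rfl
  rw [← h3]
  exact pow_le_pow_left₀ (norm_nonneg _) (norm_fst_le u) 2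

/-- A weight that is bounded on `(0, 1]` and by a multiple of the potential beyond is controlled by
the energy: near `0` because `|u(t)|² ≤ t ‖u‖² / a`, where `a` is the kinetic coefficient. -/
lemma integrable_weight_mul_sq (hn : 2 ≤ n) (hΛ : Λ < 0) {ρ : ℝ → ℝ} (hρ : Measurable ρ)
    (h0 : ∀ t, 0 < t → 0 ≤ ρ t) {C D : ℝ}
    (hle : ∀ t, 0 < t → ρ t ≤ (Ioc 0 1).indicator (fun _ => C) t + D * potential n Λ t)
    (u : energySpace n Λ) :
    Integrable (fun t => ρ t * ‖fn u t‖ ^ 2) lebesgue ∧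
      (0 ≤ C → 0 ≤ D →
        ∫ t, ρ t * ‖fn u t‖ ^ 2 ∂lebesgue ≤ (C / kinCoeff n + D) * ‖u‖ ^ 2) := by
  have ha := kinCoeff_pos hn
  obtain ⟨hp1, hp2⟩ := integrable_potential_mul_sq u
  set B : ℝ → ℝ := fun t => (Ioc (0 : ℝ) 1).indicator (fun _ => |C| * (‖u‖ ^ 2 / kinCoeff n)) t +
    |D| * (potential n Λ t * ‖fn u t‖ ^ 2) with hB
  have hind : Integrable ((Ioc (0 : ℝ) 1).indicator fun _ => |C| * (‖u‖ ^ 2 / kinCoeff n))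
      lebesgue := by
    rw [integrable_indicator_iff measurableSet_Ioc, IntegrableOn, lebesgue_restrict_Ioc]
    exact integrable_const _
  have hBint : Integrable B lebesgue := hind.add (hp1.const_mul _)
  have hbound : ∀ᵐ t ∂lebesgue, ρ t * ‖fn u t‖ ^ 2 ≤ B t := by
    filter_upwards [fn_ae_eq_rep hn hΛ u, ae_restrict_mem measurableSet_Ioi] with t ht ht0
    have ht0 : 0 < t := ht0
    have h1 := mul_le_mul_of_nonneg_right (hle t ht0) (sq_nonneg ‖fn u t‖)
    refine h1.trans ?_
    rw [add_mul, hB]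
    refine add_le_add ?_ ?_
    · by_cases hm : t ∈ Ioc (0 : ℝ) 1
      · rw [indicator_of_mem hm, indicator_of_mem hm]
        have h2 := norm_rep_sq_le hn u ht0.le
        rw [ht]
        have h3 : t / kinCoeff n * ‖u‖ ^ 2 ≤ ‖u‖ ^ 2 / kinCoeff n := by
          rw [div_mul_eq_mul_div]
          gcongr
          exact mul_le_of_le_one_left (sq_nonneg _) hm.2
        exact mul_le_mul (le_abs_self C) (h2.trans h3) (sq_nonneg _) (abs_nonneg _)
      · rw [indicator_of_notMem hm, indicator_of_notMem hm, zero_mul]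
    · rw [mul_assoc]
      exact mul_le_mul_of_nonneg_right (le_abs_self D)
        (mul_nonneg (potential_nonneg t) (sq_nonneg _))
  have hint : Integrable (fun t => ρ t * ‖fn u t‖ ^ 2) lebesgue := by
    refine hBint.mono' (hρ.aestronglyMeasurable.mul
      ((aestronglyMeasurable_fn hn hΛ u).norm.pow 2)) ?_
    filter_upwards [hbound, ae_restrict_mem measurableSet_Ioi] with t ht ht0
    rwa [Real.norm_of_nonneg (mul_nonneg (h0 t ht0) (sq_nonneg _))]
  refine ⟨hint, fun hC hD => ?_⟩
  calc ∫ t, ρ t * ‖fn u t‖ ^ 2 ∂lebesgue ≤ ∫ t, B t ∂lebesgue :=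
        integral_mono_ae hint hBint hbound
    _ = C * (‖u‖ ^ 2 / kinCoeff n) + D * ∫ t, potential n Λ t * ‖fn u t‖ ^ 2 ∂lebesgue := by
        rw [hB, integral_add hind (hp1.const_mul _), integral_const_mul,
          integral_indicator measurableSet_Ioc, lebesgue_restrict_Ioc, abs_of_nonneg hC,
          abs_of_nonneg hD]
        simp
    _ ≤ C * (‖u‖ ^ 2 / kinCoeff n) + D * ‖u‖ ^ 2 := by gcongr
    _ = _ := by ring

lemma norm_toLp_sq {ν : Measure ℝ} {f : ℝ → ℂ} (hf : MemLp f 2 ν) :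
    ‖hf.toLp f‖ ^ 2 = ∫ t, ‖f t‖ ^ 2 ∂ν := by
  have h : ((‖hf.toLp f‖ ^ 2 : ℝ) : ℂ) = ((∫ t, ‖f t‖ ^ 2 ∂ν : ℝ) : ℂ) := by
    have h1 := inner_self_eq_norm_sq_to_K (𝕜 := ℂ) (hf.toLp f)
    rw [L2.inner_def] at h1
    rw [← integral_complex_ofReal]
    push_cast
    refine Eq.trans h1.symm (integral_congr_ae ?_)
    filter_upwards [hf.coeFn_toLp] with t ht
    rw [ht, inner_self_eq_norm_sq_to_K]
    rfl
  exact_mod_cast h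

/-- The inclusion of `𝓗` in `L²(ν)`, for a measure `ν` whose `L²` norm is dominated by the energy
norm. -/
lemma exists_inclusion (hn : 2 ≤ n) (hΛ : Λ < 0) {ν : Measure ℝ} (hν : ν ≪ lebesgue)
    (hmem : ∀ u : energySpace n Λ, MemLp (fn u) 2 ν) {C : ℝ} (hC : 0 ≤ C)
    (hle : ∀ u : energySpace n Λ, ∫ t, ‖fn u t‖ ^ 2 ∂ν ≤ C * ‖u‖ ^ 2) :
    ∃ J : energySpace n Λ →L[ℂ] Lp ℂ 2 ν,
      (∀ u, J u = (hmem u).toLp (fn u)) ∧ ‖J‖ ≤ √C := by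
  let J₀ : energySpace n Λ →ₗ[ℂ] Lp ℂ 2 ν :=
    { toFun := fun u => (hmem u).toLp (fn u)
      map_add' := fun u v => by
        rw [← MemLp.toLp_add, MemLp.toLp_eq_toLp_iff]
        exact hν.ae_le (fn_add hn hΛ u v)
      map_smul' := fun c u => by
        rw [RingHom.id_apply, ← MemLp.toLp_const_smul, MemLp.toLp_eq_toLp_iff]
        exact hν.ae_le (fn_smul hn hΛ c u) }
  have hb : ∀ u, ‖J₀ u‖ ≤ √C * ‖u‖ := fun u => by
    have h : ‖J₀ u‖ ^ 2 ≤ (√C * ‖u‖) ^ 2 := by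
      rw [mul_pow, Real.sq_sqrt hC]
      exact (norm_toLp_sq (hmem u)).trans_le (hle u)
    exact (abs_le_of_sq_le_sq' h (by positivity)).2
  exact ⟨J₀.mkContinuous _ hb, fun _ => rfl, J₀.mkContinuous_norm_le (Real.sqrt_nonneg _) hb⟩

lemma toReal_smul_ae {ρ : ℝ → ℝ} (h0 : ∀ t, 0 < t → 0 ≤ ρ t) (f : ℝ → ℂ) :
    (fun t => (ENNReal.ofReal (ρ t)).toReal • f t) =ᵐ[lebesgue] fun t => (ρ t : ℂ) * f t := by
  filter_upwards [ae_restrict_mem measurableSet_Ioi] with t ht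
  rw [ENNReal.toReal_ofReal (h0 t ht), Complex.real_smul]

/-- The operator on `𝓗` that represents the weighted form `(u, v) ↦ ∫ ρ ū v`. It is `J* J` for the
inclusion `J` of `𝓗` in `L²(ρ dt)`. -/
lemma exists_weightOperator (hn : 2 ≤ n) (hΛ : Λ < 0) {ρ : ℝ → ℝ} (hρ : Measurable ρ)
    (h0 : ∀ t, 0 < t → 0 ≤ ρ t) {C D : ℝ} (hC : 0 ≤ C) (hD : 0 ≤ D)
    (hle : ∀ t, 0 < t → ρ t ≤ (Ioc 0 1).indicator (fun _ => C) t + D * potential n Λ t) :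
    (∀ u v : energySpace n Λ,
      Integrable (fun t => (ρ t : ℂ) * (conj (fn u t) * fn v t)) lebesgue) ∧
    ∃ A : energySpace n Λ →L[ℂ] energySpace n Λ,
      (∀ u v, inner ℂ (A u) v = ∫ t, (ρ t : ℂ) * (conj (fn u t) * fn v t) ∂lebesgue) ∧
      (∀ u v, inner ℂ u (A v) = inner ℂ (A u) v) ∧ ‖A‖ ≤ C / kinCoeff n + D := by
  set ν : Measure ℝ := lebesgue.withDensity fun t => ENNReal.ofReal (ρ t) with hνdef
  have hm : Measurable fun t => ENNReal.ofReal (ρ t) := hρ.ennreal_ofReal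
  have hlt : ∀ᵐ t ∂lebesgue, ENNReal.ofReal (ρ t) < ∞ := by simp
  have hν : ν ≪ lebesgue := withDensity_absolutelyContinuous _ _
  have hcast : ∀ u : energySpace n Λ,
      (fun t => (ENNReal.ofReal (ρ t)).toReal • ‖fn u t‖ ^ 2) =ᵐ[lebesgue]
        fun t => ρ t * ‖fn u t‖ ^ 2 := fun u => by
    filter_upwards [ae_restrict_mem measurableSet_Ioi] with t ht
    rw [ENNReal.toReal_ofReal (h0 t ht), smul_eq_mul]
  have hw := fun u => integrable_weight_mul_sq hn hΛ hρ h0 hle u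
  have hmem : ∀ u : energySpace n Λ, MemLp (fn u) 2 ν := fun u => by
    rw [memLp_two_iff_integrable_sq_norm ((aestronglyMeasurable_fn hn hΛ u).mono_ac hν),
      integrable_withDensity_iff_integrable_smul' hm hlt]
    exact (hw u).1.congr (hcast u).symm
  have hCD : 0 ≤ C / kinCoeff n + D := add_nonneg (div_nonneg hC (kinCoeff_pos hn).le) hD
  obtain ⟨J, hJ, hJn⟩ := exists_inclusion hn hΛ hν hmem hCD fun u => by
    rw [hνdef, integral_withDensity_eq_integral_toReal_smul hm hlt, integral_congr_ae (hcast u)]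
    exact (hw u).2 hC hD
  have hinner : ∀ u v, (fun t => inner ℂ (J u t) (J v t)) =ᵐ[ν]
      fun t => conj (fn u t) * fn v t := fun u v => by
    rw [hJ, hJ]
    filter_upwards [(hmem u).coeFn_toLp, (hmem v).coeFn_toLp] with t h1 h2
    rw [h1, h2, RCLike.inner_apply']
  refine ⟨fun u v => ?_, (ContinuousLinearMap.adjoint J).comp J, fun u v => ?_, fun u v => ?_, ?_⟩
  · have h := (L2.integrable_inner (𝕜 := ℂ) (J u) (J v)).congr (hinner u v)
    rw [integrable_withDensity_iff_integrable_smul' hm hlt] at h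
    exact h.congr (toReal_smul_ae h0 _)
  · rw [ContinuousLinearMap.comp_apply, ContinuousLinearMap.adjoint_inner_left, L2.inner_def,
      integral_congr_ae (hinner u v), integral_withDensity_eq_integral_toReal_smul hm hlt]
    exact integral_congr_ae (toReal_smul_ae h0 _)
  · rw [ContinuousLinearMap.comp_apply, ContinuousLinearMap.comp_apply,
      ContinuousLinearMap.adjoint_inner_left, ContinuousLinearMap.adjoint_inner_right]
  · rw [ContinuousLinearMap.norm_adjoint_comp_self, ← Real.mul_self_sqrt hCD]
    exact mul_self_le_mul_self (by positivity) hJn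

/-- The operators `∫₀ᴿ ρ(t) ⟨k_t, ·⟩ k_t dt`, where `k_t` represents evaluation at `t`, are norm
convergent integrals of rank one operators, hence compact. -/
lemma exists_truncatedOperator (hn : 2 ≤ n) (hΛ : Λ < 0) {ρ : ℝ → ℝ} (hρ : Continuous ρ) (R : ℝ) :
    ∃ A : energySpace n Λ →L[ℂ] energySpace n Λ, IsCompactOperator A ∧
      ∀ u v, inner ℂ u (A v) = ∫ t in Ioc 0 R, (ρ t : ℂ) * (conj (fn u t) * fn v t) := by
  obtain ⟨A, hA, hA'⟩ := exists_compactOperator_integral hρ (continuous_evalVec (n := n) (Λ := Λ)) R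
  refine ⟨A, hA, fun u v => ?_⟩
  rw [hA']
  refine integral_congr_ae ?_
  have hae : ∀ w : energySpace n Λ, fn w =ᵐ[volume.restrict (Ioc 0 R)] rep w := fun w => by
    rw [← lebesgue_restrict_Ioc]
    exact ae_restrict_of_ae (fn_ae_eq_rep hn hΛ w)
  filter_upwards [hae u, hae v] with t hu hv
  have hc : conj (inner ℂ (evalVec n Λ t) u) = inner ℂ u (evalVec n Λ t) :=
    inner_conj_symm (𝕜 := ℂ) u (evalVec n Λ t)
  rw [hu, hv, ← inner_evalVec hn, ← inner_evalVec hn, hc]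

/-! ### Simplicity of the eigenvalues -/

section Calculus

lemma exists_Icc_of_isCompact {K : Set ℝ} (hK : IsCompact K) (h : K ⊆ Ioi 0) :
    ∃ δ M : ℝ, 0 < δ ∧ δ ≤ M ∧ K ⊆ Icc δ M := by
  have hK' : IsCompact (insert 1 K) := hK.insert 1
  have hne : (insert 1 K).Nonempty := insert_nonempty 1 K
  obtain ⟨δ, hδ⟩ := hK'.exists_isLeast hne
  obtain ⟨M, hM⟩ := hK'.exists_isGreatest hne
  refine ⟨δ, M, ?_, hδ.2 hM.1, fun x hx => ⟨hδ.2 (mem_insert_of_mem _ hx),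
    hM.2 (mem_insert_of_mem _ hx)⟩⟩
  rcases hδ.1 with h1 | h1
  · rw [h1]; exact one_pos
  · exact h h1

/-- A smooth function with compact support in `(0, ∞)` and integral zero is the derivative of a
function of the same kind. -/
lemma exists_primitive_of_integral_eq_zero {χ : ℝ → ℝ} (hχ : ContDiff ℝ (⊤ : ℕ∞) χ)
    (hc : HasCompactSupport χ) (hs : tsupport χ ⊆ Ioi 0) (h0 : ∫ t, χ t = 0) :
    ∃ φ : ℝ → ℝ, ContDiff ℝ (⊤ : ℕ∞) φ ∧ HasCompactSupport φ ∧ tsupport φ ⊆ Ioi 0 ∧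
      deriv φ = χ := by
  obtain ⟨δ, M, hδ, hδM, hK⟩ := exists_Icc_of_isCompact hc hs
  have hχ0 : ∀ t, t ∉ Icc δ M → χ t = 0 := fun t ht => by
    by_contra h
    exact ht (hK (subset_tsupport _ h))
  have hd : ∀ t, HasDerivAt (fun t => ∫ s in (0 : ℝ)..t, χ s) (χ t) t := fun t =>
    hχ.continuous.integral_hasStrictDerivAt 0 t |>.hasDerivAt
  have hderiv : deriv (fun t => ∫ s in (0 : ℝ)..t, χ s) = χ := funext fun t => (hd t).deriv
  have hsupp : Function.support (fun t => ∫ s in (0 : ℝ)..t, χ s) ⊆ Icc δ M := by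
    intro t ht
    by_contra hmem
    apply ht
    rcases lt_or_ge t δ with h | h
    · refine intervalIntegral.integral_zero_ae (Eventually.of_forall fun s hs => hχ0 s ?_)
      intro hs'
      rcases le_total 0 t with h' | h'
      · rw [uIoc_of_le h'] at hs
        exact absurd hs'.1 (not_le.2 (hs.2.trans_lt h))
      · rw [uIoc_of_ge h'] at hs
        exact absurd (hδ.trans_le hs'.1) (not_lt.2 hs.2)
    · have h1 : M < t := by
        by_contra h2
        exact hmem ⟨h, not_lt.1 h2⟩
      have h2 : 0 ≤ t := (hδ.le.trans hδM).trans h1.le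
      change ∫ s in (0 : ℝ)..t, χ s = 0
      rw [intervalIntegral.integral_of_le h2]
      refine (setIntegral_eq_integral_of_forall_compl_eq_zero
        fun s hs => hχ0 s fun hs' => hs ?_).trans h0
      exact ⟨hδ.trans_le hs'.1, hs'.2.trans h1.le⟩
  have hts : tsupport (fun t => ∫ s in (0 : ℝ)..t, χ s) ⊆ Icc δ M :=
    closure_minimal hsupp isClosed_Icc
  refine ⟨fun t => ∫ s in (0 : ℝ)..t, χ s, ?_,
    HasCompactSupport.of_support_subset_isCompact isCompact_Icc hsupp,
    hts.trans fun t ht => hδ.trans_le ht.1, hderiv⟩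
  rw [contDiff_infty_iff_deriv, hderiv]
  exact ⟨fun t => (hd t).differentiableAt, hχ⟩

/-- **Du Bois-Reymond lemma** on `(0, ∞)`: a locally integrable function whose distributional
derivative vanishes is almost everywhere constant. -/
lemma ae_eq_const_of_integral_deriv_smul_eq_zero {f : ℝ → ℂ} (hf : LocallyIntegrable f)
    (h : ∀ φ : ℝ → ℝ, ContDiff ℝ (⊤ : ℕ∞) φ → HasCompactSupport φ → tsupport φ ⊆ Ioi 0 →
      ∫ t, deriv φ t • f t = 0) :
    ∃ c : ℂ, ∀ᵐ t, t ∈ Ioi (0 : ℝ) → f t = c := by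
  let b : ContDiffBump (1 : ℝ) := ⟨1 / 4, 1 / 2, by norm_num, by norm_num⟩
  let η : ℝ → ℝ := b.normed volume
  have hη : ContDiff ℝ (⊤ : ℕ∞) η := b.contDiff_normed
  have hηc : HasCompactSupport η := b.hasCompactSupport_normed
  have hηs : tsupport η ⊆ Ioi 0 := by
    rw [b.tsupport_normed_eq]
    intro t ht
    rw [Metric.mem_closedBall, Real.dist_eq] at ht
    have : b.rOut = 1 / 2 := rfl
    rw [this] at ht
    have := (abs_le.1 ht).1
    rw [mem_Ioi]
    linarith
  have hη1 : ∫ t, η t = 1 := b.integral_normed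
  have hint : ∀ ψ : ℝ → ℝ, ContDiff ℝ (⊤ : ℕ∞) ψ → HasCompactSupport ψ →
      Integrable fun t => ψ t • f t := fun ψ hψ hψc =>
    hf.integrable_smul_left_of_hasCompactSupport hψ.continuous hψc
  refine ⟨∫ t, η t • f t, ?_⟩
  have key := isOpen_Ioi.ae_eq_zero_of_integral_contDiff_smul_eq_zero (μ := volume)
    (f := fun t => f t - ∫ t, η t • f t) (U := Ioi (0 : ℝ))
    ((hf.sub (locallyIntegrable_const _)).locallyIntegrableOn _) ?_
  · filter_upwards [key] with t ht ht0
    exact sub_eq_zero.1 (ht ht0)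
  intro ψ hψ hψc hψs
  have hψi : Integrable ψ := hψ.continuous.integrable_of_hasCompactSupport hψc
  have hηi : Integrable η := hη.continuous.integrable_of_hasCompactSupport hηc
  set m := ∫ t, ψ t with hm
  -- Subtracting a multiple of `η` makes the integral of `ψ` vanish.
  obtain ⟨φ, hφ, hφc, hφs, hφd⟩ := exists_primitive_of_integral_eq_zero
    (χ := fun t => ψ t - m * η t) (hψ.sub (contDiff_const.mul hη))
    (hψc.sub (hηc.mul_left (f := fun _ => m)))
    ((tsupport_sub _ _).trans (union_subset hψs ((tsupport_mul_subset_right).trans hηs)))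
    (by rw [integral_sub hψi (hηi.const_mul m), integral_const_mul, hη1, ← hm]; ring)
  have h1 := h φ hφ hφc hφs
  rw [hφd] at h1
  have h2 : ∀ t, (ψ t - m * η t) • f t = ψ t • f t - m • η t • f t := fun t => by
    rw [sub_smul, mul_smul]
  simp only [h2] at h1
  have hm' : Integrable fun t => m • η t • f t := (hint η hη hηc).smul m
  rw [integral_sub (hint ψ hψ hψc) hm', integral_smul] at h1
  have h3 : Integrable fun t => ψ t • ∫ t, η t • f t := hψi.smul_const _
  simp only [smul_sub]
  rw [integral_sub (hint ψ hψ hψc) h3, integral_smul_const]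
  exact h1

/-- Uniqueness for the initial value problem `f'' = q f`, `f(0) = f'(0) = 0` in integrated form. -/
lemma eq_zero_of_eq_integral_integral {f q : ℝ → ℂ} (hf : Continuous f) (hq : Continuous q)
    (h : ∀ t, 0 ≤ t → f t = ∫ s in (0 : ℝ)..t, ∫ r in (0 : ℝ)..s, q r * f r) {T : ℝ}
    (hT : 0 ≤ T) : f T = 0 := by
  set Q : ℝ → ℂ := fun s => ∫ r in (0 : ℝ)..s, q r * f r with hQ
  have hQd : ∀ t, HasDerivAt Q (q t * f t) t := fun t =>
    ((hq.mul hf).integral_hasStrictDerivAt 0 t).hasDerivAt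
  have hQc : Continuous Q := continuous_iff_continuousAt.2 fun t => (hQd t).continuousAt
  have hFd : ∀ t, HasDerivAt (fun t => ∫ s in (0 : ℝ)..t, Q s) (Q t) t := fun t =>
    (hQc.integral_hasStrictDerivAt 0 t).hasDerivAt
  obtain ⟨C, hC⟩ := isCompact_Icc.exists_bound_of_continuousOn (s := Icc 0 T) hq.continuousOn
  have hy : ∀ t, HasDerivAt (fun t => ((∫ s in (0 : ℝ)..t, Q s), Q t)) (Q t, q t * f t) t :=
    fun t => (hFd t).prodMk (hQd t)
  -- Gronwall for the first order system satisfied by `(f, f')`, with zero initial value.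
  have hg := norm_le_gronwallBound_of_norm_deriv_right_le (a := 0) (b := T) (δ := 0)
    (K := max 1 C) (ε := 0) (f := fun t => ((∫ s in (0 : ℝ)..t, Q s), Q t))
    (f' := fun t => (Q t, q t * f t))
    (fun t _ => (hy t).continuousAt.continuousWithinAt) (fun t _ => (hy t).hasDerivWithinAt)
    (by simp [hQ]) (fun t ht => by
      rw [add_zero, Prod.norm_mk, Prod.norm_mk, ← h t ht.1]
      refine max_le ?_ ?_
      · exact (le_max_right _ _).trans
          (le_mul_of_one_le_left ((norm_nonneg _).trans (le_max_left _ _)) (le_max_left _ _))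
      · rw [norm_mul]
        exact mul_le_mul ((hC t ⟨ht.1, ht.2.le⟩).trans (le_max_right _ _)) (le_max_left _ _)
          (norm_nonneg _) (zero_le_one.trans (le_max_left _ _))) T ⟨hT, le_rfl⟩
  rw [gronwallBound_ε0_δ0] at hg
  have h1 := norm_le_zero_iff.1 hg
  rw [h T hT]
  exact congrArg Prod.fst h1

end Calculus

/-- A smooth real function with compact support in `(0, ∞)` as a complex test function. -/
def testOfReal (φ : ℝ → ℝ) (hφ : ContDiff ℝ (⊤ : ℕ∞) φ) (hc : HasCompactSupport φ)
    (hs : tsupport φ ⊆ Ioi 0) : Test where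
  toFun t := (φ t : ℂ)
  contDiff' := Complex.ofRealCLM.contDiff.comp hφ
  hasCompactSupport' := hc.comp_left Complex.ofReal_zero
  tsupport_subset' := (closure_mono fun t ht => by
    intro h
    exact ht (by simp [h])).trans hs

/-- The coefficient `q` of the equation `w'' = q w` for the eigenvalue `r`. -/
noncomputable def odeCoeff (n : ℕ) (Λ r t : ℝ) : ℝ :=
  (potential n Λ t - r * t ^ (2 - 4 / (n : ℝ))) / kinCoeff n

lemma two_sub_four_div_nonneg (hn : 2 ≤ n) : 0 ≤ 2 - 4 / (n : ℝ) := by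
  have h2 : (2 : ℝ) ≤ n := by exact_mod_cast hn
  rw [sub_nonneg, div_le_iff₀ (by linarith)]
  linarith

lemma continuous_weight (hn : 2 ≤ n) : Continuous fun t : ℝ => t ^ (2 - 4 / (n : ℝ)) :=
  continuous_id.rpow_const fun _ => Or.inr (two_sub_four_div_nonneg hn)

lemma continuous_odeCoeff (hn : 2 ≤ n) (r : ℝ) : Continuous (odeCoeff n Λ r) :=
  (((continuous_potential n Λ).sub ((continuous_weight hn).const_mul r))).div_const _

lemma locallyIntegrable_indicator_dfn (hn : 2 ≤ n) (u : energySpace n Λ) :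
    LocallyIntegrable ((Ioi (0 : ℝ)).indicator (dfn u)) := by
  rw [locallyIntegrable_iff]
  intro K hK
  obtain ⟨M, hM⟩ := hK.bddAbove
  have h1 : IntegrableOn (dfn u) (Ioc 0 (max M 0)) :=
    (intervalIntegrable_iff_integrableOn_Ioc_of_le (le_max_right _ _)).1
      (intervalIntegrable_dfn hn u (le_max_right _ _))
  rw [IntegrableOn, integrable_indicator_iff measurableSet_Ioi, IntegrableOn,
    Measure.restrict_restrict measurableSet_Ioi]
  exact h1.mono_set fun t ht => ⟨ht.1, (hM ht.2).trans (le_max_left _ _)⟩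

/-- The eigenvalue equation tested against real test functions, in terms of the continuous
representative. -/
lemma integral_deriv_smul_dfn (hn : 2 ≤ n) (hΛ : Λ < 0) {u : energySpace n Λ} {r : ℝ}
    (hu : ∀ φ : energySpace n Λ, energyForm u φ = r * weightForm u φ)
    {φ : ℝ → ℝ} (hφ : ContDiff ℝ (⊤ : ℕ∞) φ) (hc : HasCompactSupport φ) (hs : tsupport φ ⊆ Ioi 0) :
    ∫ t, deriv φ t • (Ioi (0 : ℝ)).indicator (dfn u) t =
      -∫ t, φ t • ((odeCoeff n Λ r t : ℂ) * rep u t) := by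
  have ha := kinCoeff_pos hn
  set Φ := testOfReal φ hφ hc hs
  have hΦd : ∀ t, deriv Φ t = ((deriv φ t : ℝ) : ℂ) := fun t =>
    ((hφ.differentiable (by simp) t).hasDerivAt.ofReal_comp).deriv
  have hφ0 : ∀ t, t ∉ Ioi (0 : ℝ) → φ t = 0 := fun t ht => by
    by_contra h
    exact ht (hs (subset_tsupport _ h))
  -- The forms are antilinear in `u`, hence the conjugation.
  have h := congrArg conj (hu (ofTest n Λ Φ))
  rw [map_mul, Complex.conj_ofReal, energyForm, weightForm, ← integral_conj, ← integral_conj] at h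
  have hL : ∫ t in Ioi (0 : ℝ), conj ((kinCoeff n : ℂ) * (conj (dfn u t) * dfn (ofTest n Λ Φ) t) +
      (potential n Λ t : ℂ) * (conj (fn u t) * fn (ofTest n Λ Φ) t)) =
      (kinCoeff n : ℂ) * (∫ t, deriv φ t • (Ioi (0 : ℝ)).indicator (dfn u) t) +
        ∫ t, φ t • ((potential n Λ t : ℂ) * rep u t) := by
    have i1 : Integrable fun t => deriv φ t • (Ioi (0 : ℝ)).indicator (dfn u) t :=
      (locallyIntegrable_indicator_dfn hn u).integrable_smul_left_of_hasCompactSupport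
        (hφ.continuous_deriv (by simp)) hc.deriv
    have i2 : Integrable fun t => φ t • ((potential n Λ t : ℂ) * rep u t) :=
      (hφ.continuous.smul ((Complex.continuous_ofReal.comp (continuous_potential n Λ)).mul
        (continuous_rep hn u))).integrable_of_hasCompactSupport hc.smul_right
    rw [← integral_const_mul, ← integral_add (i1.const_mul _) i2,
      ← integral_indicator measurableSet_Ioi]
    refine integral_congr_ae ?_
    have := (ae_restrict_iff' measurableSet_Ioi).1
      ((dfn_ofTest (Λ := Λ) hn Φ).and ((fn_ofTest hn hΛ Φ).and (fn_ae_eq_rep hn hΛ u)))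
    filter_upwards [this] with t ht
    by_cases h0 : t ∈ Ioi (0 : ℝ)
    · obtain ⟨e1, e2, e3⟩ := ht h0
      rw [indicator_of_mem h0, indicator_of_mem h0, e1, e2, e3, hΦd]
      change conj ((kinCoeff n : ℂ) * (conj (dfn u t) * ((deriv φ t : ℝ) : ℂ)) +
        (potential n Λ t : ℂ) * (conj (rep u t) * (φ t : ℂ))) = _
      simp only [map_add, map_mul, Complex.conj_ofReal, Complex.conj_conj, Complex.real_smul]
      ring
    · rw [indicator_of_notMem h0, indicator_of_notMem h0, hφ0 t h0]
      simp
  have hR : ∫ t in Ioi (0 : ℝ), conj (((t ^ (2 - 4 / (n : ℝ)) : ℝ) : ℂ) *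
      (conj (fn u t) * fn (ofTest n Λ Φ) t)) =
      ∫ t, φ t • (((t ^ (2 - 4 / (n : ℝ)) : ℝ) : ℂ) * rep u t) := by
    rw [← integral_indicator measurableSet_Ioi]
    refine integral_congr_ae ?_
    have := (ae_restrict_iff' measurableSet_Ioi).1
      ((fn_ofTest hn hΛ Φ).and (fn_ae_eq_rep hn hΛ u))
    filter_upwards [this] with t ht
    by_cases h0 : t ∈ Ioi (0 : ℝ)
    · obtain ⟨e2, e3⟩ := ht h0
      rw [indicator_of_mem h0, e2, e3]
      change conj (((t ^ (2 - 4 / (n : ℝ)) : ℝ) : ℂ) * (conj (rep u t) * (φ t : ℂ))) = _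
      simp only [map_mul, Complex.conj_ofReal, Complex.conj_conj, Complex.real_smul]
      ring
    · rw [indicator_of_notMem h0, hφ0 t h0]
      simp
  rw [hL, hR] at h
  have ha' : (kinCoeff n : ℂ) ≠ 0 := by exact_mod_cast ha.ne'
  have i2 : Integrable fun t => φ t • ((potential n Λ t : ℂ) * rep u t) :=
    (hφ.continuous.smul ((Complex.continuous_ofReal.comp (continuous_potential n Λ)).mul
      (continuous_rep hn u))).integrable_of_hasCompactSupport hc.smul_right
  have i3 : Integrable fun t => φ t • (((t ^ (2 - 4 / (n : ℝ)) : ℝ) : ℂ) * rep u t) :=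
    (hφ.continuous.smul ((Complex.continuous_ofReal.comp (continuous_weight hn)).mul
      (continuous_rep hn u))).integrable_of_hasCompactSupport hc.smul_right
  have hq : (kinCoeff n : ℂ) * ∫ t, φ t • ((odeCoeff n Λ r t : ℂ) * rep u t) =
      (∫ t, φ t • ((potential n Λ t : ℂ) * rep u t)) -
        r * ∫ t, φ t • (((t ^ (2 - 4 / (n : ℝ)) : ℝ) : ℂ) * rep u t) := by
    rw [← integral_const_mul, ← integral_const_mul, ← integral_sub i2 (i3.const_mul _)]
    congr 1 with t
    simp only [odeCoeff, Complex.real_smul]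
    push_cast
    field_simp
  refine mul_left_cancel₀ ha' ?_
  rw [mul_neg, hq, ← h]
  ring

/-- A weak solution is a classical one: its representative satisfies the integrated equation
`w(t) = ∫₀ᵗ (c + ∫₀ˢ q w)`. -/
lemma exists_rep_eq_integral (hn : 2 ≤ n) (hΛ : Λ < 0) {u : energySpace n Λ} {r : ℝ}
    (hu : ∀ φ : energySpace n Λ, energyForm u φ = r * weightForm u φ) :
    ∃ c : ℂ, ∀ t, 0 ≤ t →
      rep u t = ∫ s in (0 : ℝ)..t, (c + ∫ x in (0 : ℝ)..s, (odeCoeff n Λ r x : ℂ) * rep u x) := by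
  have hcont : Continuous fun x => (odeCoeff n Λ r x : ℂ) * rep u x :=
    (Complex.continuous_ofReal.comp (continuous_odeCoeff hn r)).mul (continuous_rep hn u)
  set Q : ℝ → ℂ := fun s => ∫ x in (0 : ℝ)..s, (odeCoeff n Λ r x : ℂ) * rep u x with hQ
  have hQd : ∀ t, HasDerivAt Q ((odeCoeff n Λ r t : ℂ) * rep u t) t := fun t =>
    (hcont.integral_hasStrictDerivAt 0 t).hasDerivAt
  have hQc : Continuous Q := continuous_iff_continuousAt.2 fun t => (hQd t).continuousAt
  have hloc := locallyIntegrable_indicator_dfn hn u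
  obtain ⟨c, hc⟩ := ae_eq_const_of_integral_deriv_smul_eq_zero (hloc.sub hQc.locallyIntegrable)
    fun φ hφ hφc hφs => by
      have hφ' : Continuous (deriv φ) := hφ.continuous_deriv (by simp)
      have i1 := hloc.integrable_smul_left_of_hasCompactSupport hφ' hφc.deriv
      have i2 : Integrable fun t => deriv φ t • Q t :=
        (hφ'.smul hQc).integrable_of_hasCompactSupport hφc.deriv.smul_right
      have i3 : Integrable fun t => φ t • ((odeCoeff n Λ r t : ℂ) * rep u t) :=
        (hφ.continuous.smul hcont).integrable_of_hasCompactSupport hφc.smul_right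
      have i4 : Integrable fun t => φ t • Q t :=
        (hφ.continuous.smul hQc).integrable_of_hasCompactSupport hφc.smul_right
      have hparts := integral_eq_zero_of_hasDerivAt_of_integrable (f := fun t => φ t • Q t)
        (f' := fun t => φ t • ((odeCoeff n Λ r t : ℂ) * rep u t) + deriv φ t • Q t)
        (fun t => (hφ.differentiable (by simp) t).hasDerivAt.smul (hQd t)) (i3.add i2) i4
      rw [integral_add i3 i2] at hparts
      simp only [Pi.sub_apply, smul_sub]
      rw [integral_sub i1 i2, integral_deriv_smul_dfn hn hΛ hu hφ hφc hφs,
        eq_neg_of_add_eq_zero_left hparts]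
      ring
  refine ⟨c, fun t ht => ?_⟩
  rw [intervalIntegral.integral_of_le ht, rep]
  refine setIntegral_congr_ae measurableSet_Ioc ?_
  filter_upwards [hc] with s hs hs0
  have h1 := hs hs0.1
  rw [Pi.sub_apply, indicator_of_mem (mem_Ioi.2 hs0.1), sub_eq_iff_eq_add] at h1
  exact h1

/-- Eigenvalues are simple: a solution is determined by its value `0` and its slope at `0`. -/
lemma exists_eq_smul_of_solutions (hn : 2 ≤ n) (hΛ : Λ < 0) {u v : energySpace n Λ} {r : ℝ}
    (hu0 : u ≠ 0) (hu : ∀ φ : energySpace n Λ, energyForm u φ = r * weightForm u φ)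
    (hv : ∀ φ : energySpace n Λ, energyForm v φ = r * weightForm v φ) :
    ∃ c : ℂ, v = c • u := by
  have hqc : Continuous fun t => (odeCoeff n Λ r t : ℂ) :=
    Complex.continuous_ofReal.comp (continuous_odeCoeff hn r)
  obtain ⟨c, hc⟩ := exists_rep_eq_integral hn hΛ hu
  obtain ⟨d, hd⟩ := exists_rep_eq_integral hn hΛ hv
  have hQ : ∀ w : energySpace n Λ, Continuous fun s =>
      ∫ x in (0 : ℝ)..s, (odeCoeff n Λ r x : ℂ) * rep w x := fun w =>
    intervalIntegral.continuous_primitive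
      (fun a b => (hqc.mul (continuous_rep hn w)).intervalIntegrable a b) 0
  -- Here `c` and `d` are the slopes at `0`, and `v - (d / c) u` has slope `0` there.
  have hc0 : c ≠ 0 := by
    rintro rfl
    refine hu0 (eq_zero_of_rep_eq_zero hn hΛ fun t ht => ?_)
    refine eq_zero_of_eq_integral_integral (continuous_rep hn u) hqc (fun s hs => ?_) ht.le
    simpa using hc s hs
  refine ⟨d / c, ?_⟩
  rw [← sub_eq_zero]
  refine eq_zero_of_rep_eq_zero hn hΛ fun t ht => ?_
  refine eq_zero_of_eq_integral_integral (continuous_rep hn _) hqc (fun s hs => ?_) ht.le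
  have hi : ∀ (e : ℂ) (w : energySpace n Λ), IntervalIntegrable (fun s => e +
      ∫ x in (0 : ℝ)..s, (odeCoeff n Λ r x : ℂ) * rep w x) volume 0 s := fun e w =>
    (continuous_const.add (hQ w)).intervalIntegrable _ _
  rw [rep_sub_smul hn, hd s hs, hc s hs, ← intervalIntegral.integral_const_mul,
    ← intervalIntegral.integral_sub (hi d v) ((hi c u).const_mul _)]
  congr 1 with x
  have h1 : ∫ y in (0 : ℝ)..x, (odeCoeff n Λ r y : ℂ) * rep (v - (d / c) • u) y =
      (∫ y in (0 : ℝ)..x, (odeCoeff n Λ r y : ℂ) * rep v y) -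
        d / c * ∫ y in (0 : ℝ)..x, (odeCoeff n Λ r y : ℂ) * rep u y := by
    have hi' : ∀ w : energySpace n Λ, IntervalIntegrable
        (fun y => (odeCoeff n Λ r y : ℂ) * rep w y) volume 0 x := fun w =>
      (hqc.mul (continuous_rep hn w)).intervalIntegrable _ _
    rw [← intervalIntegral.integral_const_mul,
      ← intervalIntegral.integral_sub (hi' v) ((hi' u).const_mul _)]
    congr 1 with y
    rw [rep_sub_smul hn]
    ring
  rw [h1]
  field_simp
  ring

/-! ### The eigenvalue problem -/

/-- Bump functions around the positive integers are linearly independent, since evaluation at these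
integers separates them. -/
lemma not_finiteDimensional_energySpace (hn : 2 ≤ n) :
    ¬ FiniteDimensional ℂ (energySpace n Λ) := by
  intro hfin
  let b : ∀ k : ℕ, ContDiffBump ((k : ℝ) + 1) := fun k =>
    ⟨1 / 4, 1 / 2, by norm_num, by norm_num⟩
  have hs : ∀ k, tsupport (b k) ⊆ Ioi 0 := fun k t ht => by
    rw [(b k).tsupport_eq, Metric.mem_closedBall, Real.dist_eq] at ht
    have h1 : |t - (k + 1)| ≤ 1 / 2 := ht
    have h2 := (abs_le.1 h1).1
    have h3 : (0 : ℝ) ≤ k := k.cast_nonneg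
    rw [mem_Ioi]
    linarith
  let v : ℕ → energySpace n Λ := fun k =>
    ofTest n Λ (testOfReal (b k) (b k).contDiff (b k).hasCompactSupport (hs k))
  let L : energySpace n Λ →ₗ[ℂ] (ℕ → ℂ) := LinearMap.pi fun j =>
    (innerSL ℂ (evalVec n Λ ((j : ℝ) + 1)) : energySpace n Λ →L[ℂ] ℂ).toLinearMap
  have hL : ∀ k, L (v k) = Pi.single k 1 := by
    intro k
    ext j
    have hj : (0 : ℝ) ≤ (j : ℝ) + 1 := by positivity
    have h1 : L (v k) j = (b k ((j : ℝ) + 1) : ℂ) :=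
      (inner_evalVec hn _ _).trans (rep_ofTest hn _ hj)
    rw [h1]
    by_cases hjk : j = k
    · subst hjk
      rw [Pi.single_eq_same, (b j).one_of_mem_closedBall
        (Metric.mem_closedBall_self (b j).rIn_pos.le), Complex.ofReal_one]
    · rw [Pi.single_eq_of_ne hjk, (b k).zero_of_le_dist, Complex.ofReal_zero]
      have h2 : (1 : ℝ) ≤ |(j : ℝ) - k| := by
        have h3 : (1 : ℤ) ≤ |(j : ℤ) - k| :=
          Int.one_le_abs (sub_ne_zero.2 (by exact_mod_cast hjk))
        exact_mod_cast h3
      rw [Real.dist_eq, add_sub_add_right_eq_sub]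
      exact (show (1 / 2 : ℝ) ≤ 1 by norm_num).trans h2
  have hli : LinearIndependent ℂ v := by
    refine LinearIndependent.of_comp L ?_
    rw [show L ∘ v = fun k => Pi.single k 1 from funext hL]
    exact Pi.linearIndependent_single_one ℕ ℂ
  exact not_finite_iff_infinite.2 (inferInstanceAs (Infinite ℕ)) hli.finite

lemma coeff_pos (hn : 2 ≤ n) (hΛ : Λ < 0) : 0 < n * |Λ| :=
  mul_pos (by exact_mod_cast (by omega : 0 < n)) (abs_pos.2 hΛ.ne)

lemma sq_eq_mul_potential (hn : 2 ≤ n) (hΛ : Λ < 0) (t : ℝ) :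
    t ^ 2 = (n * |Λ|)⁻¹ * potential n Λ t := by
  rw [potential, inv_mul_cancel_left₀ (coeff_pos hn hΛ).ne']

lemma weight_le (hn : 2 ≤ n) (hΛ : Λ < 0) {p : ℝ} (hp0 : 0 ≤ p) (hp2 : p ≤ 2) (t : ℝ)
    (ht : 0 < t) :
    t ^ p ≤ (Ioc 0 1).indicator (fun _ => (1 : ℝ)) t + (n * |Λ|)⁻¹ * potential n Λ t := by
  rw [← sq_eq_mul_potential hn hΛ]
  rcases le_or_gt t 1 with h | h
  · rw [indicator_of_mem (mem_Ioc.2 ⟨ht, h⟩)]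
    exact (Real.rpow_le_one ht.le h hp0).trans (le_add_of_nonneg_right (sq_nonneg t))
  · rw [indicator_of_notMem fun h' => absurd h'.2 (not_le.2 h), zero_add, ← Real.rpow_two]
    exact Real.rpow_le_rpow_of_exponent_le h.le hp2

/-- Beyond `R` the weight is at most `R^{-4/n}` times `t²`, so that the part of the weight operator
beyond `R` is small in norm. -/
lemma weight_tail_le (hn : 2 ≤ n) (hΛ : Λ < 0) {R : ℝ} (hR : 0 < R) (t : ℝ) (ht : 0 < t) :
    (Ioi R).indicator (fun t => t ^ (2 - 4 / (n : ℝ))) t ≤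
      (Ioc 0 1).indicator (fun _ => (0 : ℝ)) t +
        R ^ (-(4 / (n : ℝ))) * (n * |Λ|)⁻¹ * potential n Λ t := by
  rw [mul_assoc, ← sq_eq_mul_potential hn hΛ, indicator_zero, zero_add]
  by_cases h : t ∈ Ioi R
  · rw [indicator_of_mem h, sub_eq_neg_add, Real.rpow_add ht, Real.rpow_two]
    refine mul_le_mul_of_nonneg_right ?_ (sq_nonneg t)
    exact Real.rpow_le_rpow_of_nonpos hR (le_of_lt h) (neg_nonpos.2 (by positivity))
  · rw [indicator_of_notMem h]
    positivity

/-- The operator representing the form `K` on `𝓗`. It is compact as a norm limit of the operators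
that represent the form truncated to `(0, R]`. -/
lemma exists_compact_weightOperator (hn : 2 ≤ n) (hΛ : Λ < 0) :
    (∀ u v : energySpace n Λ, Integrable
      (fun t => ((t ^ (2 - 4 / (n : ℝ)) : ℝ) : ℂ) * (conj (fn u t) * fn v t)) lebesgue) ∧
    ∃ A : energySpace n Λ →L[ℂ] energySpace n Λ, IsCompactOperator A ∧
      (∀ u v, inner ℂ (A u) v = weightForm u v) ∧
      ∀ u v, inner ℂ u (A v) = inner ℂ (A u) v := by
  have hwm : Measurable fun t : ℝ => t ^ (2 - 4 / (n : ℝ)) := (continuous_weight hn).measurable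
  have hw0 : ∀ t : ℝ, 0 < t → 0 ≤ t ^ (2 - 4 / (n : ℝ)) := fun t ht => Real.rpow_nonneg ht.le _
  have hb := coeff_pos hn hΛ
  obtain ⟨hint, A, hA, hAs, -⟩ := exists_weightOperator hn hΛ hwm hw0 zero_le_one
    (inv_nonneg.2 hb.le) (weight_le hn hΛ (two_sub_four_div_nonneg hn)
      (sub_le_self _ (by positivity)))
  refine ⟨hint, A, ?_, hA, hAs⟩
  have hR : ∀ N : ℕ, (0 : ℝ) < (N : ℝ) + 1 := fun N => N.cast_add_one_pos
  have htail := fun N : ℕ => exists_weightOperator (n := n) (Λ := Λ) hn hΛ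
    (ρ := (Ioi ((N : ℝ) + 1)).indicator fun t => t ^ (2 - 4 / (n : ℝ)))
    (hwm.indicator measurableSet_Ioi)
    (fun t ht => indicator_apply_nonneg fun _ => hw0 t ht) le_rfl
    (mul_nonneg (Real.rpow_nonneg (hR N).le _) (inv_nonneg.2 hb.le))
    (weight_tail_le hn hΛ (hR N))
  choose hTint T hT hTs hTn using htail
  have htrunc := fun N : ℕ => exists_truncatedOperator (n := n) (Λ := Λ) hn hΛ
    (continuous_weight hn) ((N : ℝ) + 1)
  choose B hBc hB using htrunc
  have hdiff : ∀ N, A - B N = T N := by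
    intro N
    refine ContinuousLinearMap.ext fun v => ext_inner_left ℂ fun u => ?_
    have h1 : inner ℂ u ((A - B N) v) = inner ℂ u (A v) - inner ℂ u (B N v) :=
      inner_sub_right (𝕜 := ℂ) u (A v) (B N v)
    rw [h1, hAs, hTs, hA, hB, hT, sub_eq_iff_eq_add', ← lebesgue_restrict_Ioc,
      ← integral_indicator measurableSet_Ioc, ← integral_add
        ((hint u v).indicator measurableSet_Ioc) (hTint N u v)]
    refine integral_congr_ae ?_
    filter_upwards [ae_restrict_mem measurableSet_Ioi] with t ht
    by_cases h : t ≤ (N : ℝ) + 1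
    · rw [indicator_of_mem (show t ∈ Ioc 0 ((N : ℝ) + 1) from ⟨ht, h⟩),
        indicator_of_notMem (show t ∉ Ioi ((N : ℝ) + 1) from not_lt.2 h)]
      simp
    · rw [indicator_of_notMem (fun h' => h h'.2), indicator_of_mem (mem_Ioi.2 (not_le.1 h)),
        zero_add]
  have hlim : Tendsto (fun N : ℕ => 0 / kinCoeff n +
      ((N : ℝ) + 1) ^ (-(4 / (n : ℝ))) * (n * |Λ|)⁻¹) atTop (𝓝 0) := by
    have h4 : (0 : ℝ) < 4 / n := div_pos four_pos (by exact_mod_cast (by omega : 0 < n))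
    have h5 := ((tendsto_rpow_neg_atTop h4).comp
      (tendsto_atTop_add_const_right _ (1 : ℝ) tendsto_natCast_atTop_atTop)).mul_const (n * |Λ|)⁻¹
    rw [zero_mul] at h5
    refine h5.congr fun N => ?_
    rw [zero_div, zero_add]
    rfl
  refine isCompactOperator_of_norm_sub_le hBc (fun N => ?_) hlim
  rw [hdiff]
  exact hTn N

lemma re_weightForm_pos (hn : 2 ≤ n) (hΛ : Λ < 0) {u : energySpace n Λ} (hu : u ≠ 0) :
    0 < (weightForm u u).re := by
  have he : ∀ t : ℝ, ((t ^ (2 - 4 / (n : ℝ)) : ℝ) : ℂ) * (conj (fn u t) * fn u t) =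
      ((t ^ (2 - 4 / (n : ℝ)) * ‖fn u t‖ ^ 2 : ℝ) : ℂ) := fun t => by
    rw [Complex.conj_mul']
    push_cast
    rfl
  have hnn : ∀ᵐ t ∂lebesgue, 0 ≤ t ^ (2 - 4 / (n : ℝ)) * ‖fn u t‖ ^ 2 := by
    filter_upwards [ae_restrict_mem measurableSet_Ioi] with t ht
    exact mul_nonneg (Real.rpow_nonneg (le_of_lt ht) _) (sq_nonneg _)
  have hint : Integrable (fun t => t ^ (2 - 4 / (n : ℝ)) * ‖fn u t‖ ^ 2) lebesgue :=
    (((exists_compact_weightOperator hn hΛ).1 u u).congr (Eventually.of_forall he)).re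
  have hw : weightForm u u = ((∫ t, t ^ (2 - 4 / (n : ℝ)) * ‖fn u t‖ ^ 2 ∂lebesgue : ℝ) : ℂ) := by
    rw [← integral_complex_ofReal]
    exact integral_congr_ae (Eventually.of_forall he)
  rw [hw, Complex.ofReal_re]
  refine lt_of_le_of_ne (integral_nonneg_of_ae hnn) fun h => hu ?_
  have hz := (integral_eq_zero_iff_of_nonneg_ae hnn hint).1 h.symm
  have hrep : rep u =ᵐ[volume.restrict (Ioi 0)] fun _ => 0 := by
    filter_upwards [hz, fn_ae_eq_rep hn hΛ u, ae_restrict_mem measurableSet_Ioi] with t h1 h2 h3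
    rw [← h2]
    have h4 := (mul_eq_zero.1 h1).resolve_left (Real.rpow_pos_of_pos h3 _).ne'
    simpa using h4
  exact eq_zero_of_rep_eq_zero hn hΛ fun t ht =>
    Measure.eqOn_open_of_ae_eq hrep isOpen_Ioi (continuous_rep hn u).continuousOn
      continuousOn_const ht

lemma exists_inclusion_lebesgue (hn : 2 ≤ n) (hΛ : Λ < 0) :
    ∃ (hL2 : ∀ u : energySpace n Λ, MemLp (fn u) 2 lebesgue)
      (J : energySpace n Λ →L[ℂ] Lp ℂ 2 lebesgue), ∀ u, J u = (hL2 u).toLp (fn u) := by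
  have hb := coeff_pos hn hΛ
  have hw := fun u : energySpace n Λ => integrable_weight_mul_sq hn hΛ (ρ := fun _ => 1)
    (C := 1) (D := (n * |Λ|)⁻¹) measurable_const (fun _ _ => zero_le_one)
    (fun t ht => by simpa using weight_le hn hΛ le_rfl zero_le_two t ht) u
  simp only [one_mul] at hw
  have hL2 : ∀ u : energySpace n Λ, MemLp (fn u) 2 lebesgue := fun u =>
    (memLp_two_iff_integrable_sq_norm (aestronglyMeasurable_fn hn hΛ u)).2 (hw u).1
  obtain ⟨J, hJ, -⟩ := exists_inclusion hn hΛ Measure.AbsolutelyContinuous.rfl hL2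
    (add_nonneg (div_nonneg zero_le_one (kinCoeff_pos hn).le) (inv_nonneg.2 hb.le))
    fun u => (hw u).2 zero_le_one (inv_nonneg.2 hb.le)
  exact ⟨hL2, J, hJ⟩

/-- Test functions, and with them `𝓗`, are dense in `L²(0, ∞)`. -/
lemma denseRange_inclusion (hn : 2 ≤ n) (hΛ : Λ < 0)
    {hL2 : ∀ u : energySpace n Λ, MemLp (fn u) 2 lebesgue}
    {J : energySpace n Λ →L[ℂ] Lp ℂ 2 lebesgue} (hJ : ∀ u, J u = (hL2 u).toLp (fn u)) :
    DenseRange J := by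
  have hrange : (LinearMap.range J.toLinearMap).topologicalClosure = ⊤ := by
    rw [Submodule.topologicalClosure_eq_top_iff, eq_bot_iff]
    intro f hf
    rw [Submodule.mem_bot, Lp.eq_zero_iff_ae_eq_zero]
    have hloc : LocallyIntegrable f lebesgue := (Lp.memLp f).locallyIntegrable (by norm_num)
    have key := isOpen_Ioi.ae_eq_zero_of_integral_contDiff_smul_eq_zero (μ := lebesgue)
      (U := Ioi (0 : ℝ)) (hloc.locallyIntegrableOn _) fun φ hφ hc hs => by
        set Φ := testOfReal φ hφ hc hs
        have h0 : inner ℂ (J (ofTest n Λ Φ)) f = 0 := hf _ ⟨ofTest n Λ Φ, rfl⟩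
        rw [L2.inner_def] at h0
        rw [← h0]
        refine integral_congr_ae ?_
        rw [hJ]
        filter_upwards [(hL2 (ofTest n Λ Φ)).coeFn_toLp, fn_ofTest hn hΛ Φ] with t h1 h2
        rw [h1, h2, RCLike.inner_apply']
        change φ t • f t = conj ((φ t : ℝ) : ℂ) * f t
        rw [Complex.conj_ofReal, Complex.real_smul]
    filter_upwards [key, ae_restrict_mem measurableSet_Ioi] with t h1 h2 using h1 h2
  have h := congrArg (fun S : Submodule ℂ (Lp ℂ 2 lebesgue) => (S : Set (Lp ℂ 2 lebesgue))) hrange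
  rw [Submodule.topologicalClosure_coe, Submodule.top_coe] at h
  exact dense_iff_closure_eq.2 h

/-- With `A` the operator representing `K`, the eigenvalue problem for `(w, μ)` reads
`w = conj μ • A w`; the conjugate comes from the forms being antilinear in the first argument. -/
lemma isSolution_iff (hn : 2 ≤ n) {A : energySpace n Λ →L[ℂ] energySpace n Λ}
    (hA : ∀ u v, inner ℂ (A u) v = weightForm u v) (w : energySpace n Λ) (μ : ℂ) :
    (∀ φ, energyForm w φ = μ * weightForm w φ) ↔ w = conj μ • A w := by
  have h : ∀ φ, μ * weightForm w φ = inner ℂ (conj μ • A w) φ := fun φ => by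
    have h1 : inner ℂ (conj μ • A w) φ = conj (conj μ) * inner ℂ (A w) φ :=
      inner_smul_left (𝕜 := ℂ) (A w) φ (conj μ)
    rw [h1, Complex.conj_conj, hA]
  constructor
  · intro hw
    refine ext_inner_right ℂ fun φ => ?_
    rw [← h, ← hw, energyForm_eq_inner (by omega)]
  · intro hw φ
    rw [h, ← hw, energyForm_eq_inner (by omega)]

end TemporalEigenvalue

theorem theorem2p2 (n : ℕ) (hn : 3 ≤ n) (Λ : ℝ) (hΛ : Λ < 0) :
    -- `K` is well defined on the energy space, which lies in `L²(0, ∞)`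
    (∀ u v : TemporalEigenvalue.energySpace n Λ,
      IntegrableOn (fun t : ℝ => ((t ^ (2 - 4 / (n : ℝ)) : ℝ) : ℂ) *
        (conj (TemporalEigenvalue.fn u t) * TemporalEigenvalue.fn v t)) (Ioi 0)) ∧
    ∃ (hL2 : ∀ u : TemporalEigenvalue.energySpace n Λ,
        MemLp (TemporalEigenvalue.fn u) 2 (volume.restrict (Ioi (0 : ℝ))))
      (w : ℕ → TemporalEigenvalue.energySpace n Λ) (eig : ℕ → ℝ),
      -- the `(w i, eig i)` are solutions, and, up to scalar factors, all of them
      (∀ i, TemporalEigenvalue.IsSolution (w i) (eig i)) ∧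
      (∀ (u : TemporalEigenvalue.energySpace n Λ) (μ : ℂ), TemporalEigenvalue.IsSolution u μ →
        ∃ i, μ = eig i ∧ ∃ c : ℂ, u = c • w i) ∧
      0 < eig 0 ∧ StrictMono eig ∧ Tendsto eig atTop atTop ∧
      (∀ i j, TemporalEigenvalue.weightForm (w i) (w j) = if i = j then 1 else 0) ∧
      -- completeness in the energy space and in `L²(0, ∞)`
      (Submodule.span ℂ (range w)).topologicalClosure = ⊤ ∧
      (Submodule.span ℂ (range fun i => (hL2 (w i)).toLp
        (TemporalEigenvalue.fn (w i)))).topologicalClosure = ⊤ := by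
  have hn2 : 2 ≤ n := by omega
  obtain ⟨hint, A, hAc, hA, hAs⟩ :=
    TemporalEigenvalue.exists_compact_weightOperator (n := n) (Λ := Λ) hn2 hΛ
  obtain ⟨hL2, J, hJ⟩ := TemporalEigenvalue.exists_inclusion_lebesgue (n := n) (Λ := Λ) hn2 hΛ
  have hiff := TemporalEigenvalue.isSolution_iff hn2 hA
  have hiff' : ∀ (w : TemporalEigenvalue.energySpace n Λ) (r : ℝ), w = (r : ℂ) • A w →
      ∀ φ, TemporalEigenvalue.energyForm w φ = r * TemporalEigenvalue.weightForm w φ :=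
    fun w r h => (hiff w r).2 (by rwa [Complex.conj_ofReal])
  obtain ⟨w, eig, h1, h2, h3, h4, h5, h6, h7⟩ :=
    TemporalEigenvalue.exists_eigenvector_sequence
      (TemporalEigenvalue.not_finiteDimensional_energySpace hn2) hAc
      (fun u v => (hAs u v).symm)
      (fun u hu => by
        rw [hA]
        exact TemporalEigenvalue.re_weightForm_pos hn2 hΛ hu)
      (fun r u v hu h h' => TemporalEigenvalue.exists_eq_smul_of_solutions hn2 hΛ hu
        (hiff' u r h) (hiff' v r h'))
  refine ⟨hint, hL2, w, eig, fun i => ⟨(h1 i).1, hiff' _ _ (h1 i).2⟩, ?_, h3, h4, h5, ?_, h7, ?_⟩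
  · rintro u μ ⟨hu, hsol⟩
    obtain ⟨i, hi, hc⟩ := h2 u (conj μ) hu ((hiff u μ).1 hsol)
    refine ⟨i, ?_, hc⟩
    rw [← Complex.conj_conj μ, hi, Complex.conj_ofReal]
  · intro i j
    rw [← hA, h6]
  · have hdense := TemporalEigenvalue.denseRange_inclusion hn2 hΛ hJ
    have hmap := hdense.topologicalClosure_map_submodule h7
    rw [Submodule.map_span, ← range_comp] at hmap
    have he : (fun i => (hL2 (w i)).toLp (TemporalEigenvalue.fn (w i))) = J ∘ w :=
      funext fun i => (hJ (w i)).symm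
    have hspan : (Submodule.span ℂ (range fun i =>
        (hL2 (w i)).toLp (TemporalEigenvalue.fn (w i)))).topologicalClosure = ⊤ := by
      rw [he]
      exact hmap
    exact hspan
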